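/- An electrical network $G=(V,E,c)$ is a connected simple graph $(V,E)$ with finitely or countably many vertices together with a function $c:V^2\to[0,\infty)$ such that $c(x,y)=c(y,x)$, $c(x,y)>0$ if and only if $\{x,y\}\in E$, and $c(x):=\sum_{y}c(x,y)<\infty$ for all $x$. Its resistance form is $\mathcal E(f,g)=\frac12\sum_{x,y}c(x,y)(f(x)-f(y))(g(x)-g(y))$ on $\mathcal F=\{f\in\mathbb R^V:\mathcal E(f,f)<\infty\}$, and its resistance metric is $R(x,y)=\sup\{|f(x)-f(y)|^2/\mathcal E(f,f): f\in\mathcal F,\ \mathcal E(f,f)>0\}$ (which induces the discrete topology on $V$). For $A,A'\subseteq V$ let $R(A,A')=(\inf\{\mathcal E(f,f): f\in\mathcal F,\ f|_A=1,\ f|_{A'}=0\})^{-1}$ (with $1/0=\infty$, and $R(A,A')=0$ if there is no such $f$). Assume that $(V,R)$ is boundedly compact, i.e. that all its balls $B_R(x,r)$ are finite, and that $(\mathcal E,\mathcal F)$ is recurrent, i.e. that $\lim_{r\to\infty}R(\{x\},B_R(x,r)^c)=\infty$ for some (equivalently, any) $x\in V$. Let $B\subseteq V$ be non-empty, and let $\mathcal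 F^{(1)}$ be the closure of the finitely supported functions in $\mathcal F$ for the inner product $\mathcal E(u,v)+u(x_0)v(x_0)$ (for any $x_0 \in V$). For a function $\varphi$ on $B$ that is the restriction of an element of $\mathcal F^{(1)}$, let $h_B(\varphi)$ be the unique minimizer of $\mathcal E(u,u)$ among $u\in\mathcal F^{(1)}$ with $u|_B=\varphi$. The trace $G|_B$ is the electrical network with vertex set $B$ and conductances $c_{G|_B}(x,y)=-\mathcal E(h_B(1_{\{x\}}),h_B(1_{\{y\}}))$ for $x\ne y$ and $c_{G|_B}(x,x)=0$ (the edges being the pairs with $c_{G|_B}(x,y)>0$). For an electrical network $G$, let $Y_G=(Y_G(k))_{k\ge0}$ be the discrete-time Markov chain on its vertex set with transition probabilities $c(x,y)/c(x)$ (on a network with a single vertex the chain is constant), and let $P^G_\rho$ be its law when started at $\rho$. Put $\tilde T^{(0)}=0$ and $\tilde T^{(k+1)}=\inf\{n\ge\tilde T^{(k)}+1: Y_G(n)\in B\setminus\{Y_G(\tilde T^{(k)})\}\}$, with $\tilde T^{(k+1)}=\tilde T^{(k)}$ if there is no such $n$, and define $\mathrm{tr}_BY_G(k)=Y_G(\tilde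 T^{(k)})$. A sequence $y$ is regarded as the càdlàg path $t\mapsto y(\lfloor t\rfloor)$, and $D(\mathbb R_+,B)$ is the space of càdlàg paths in the discrete space $B$, with the $J_1$-Skorohod topology and its Borel $\sigma$-algebra. Theorem. The trace $G|_B$ is indeed an electrical network, and for every $\rho\in B$, $$P^G_\rho(\mathrm{tr}_BY_G\in\cdot)=P^{G|_B}_\rho(Y_{G|_B}\in\cdot)$$ as probability measures on $D(\mathbb R_+,B)$. -/

import Mathlib

open MeasureTheory ProbabilityTheory Filter Topology
open scoped NNReal ENNReal

/-- An electrical network with vertex set `V`: a connected simple graph with conductances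
`cond x y ≥ 0` which are symmetric, positive exactly on the edges, and have finite sum at each
vertex. (That `V` is countable is assumed separately, by `[Countable V]`.) -/
@[ext]
structure ElectricalNetwork (V : Type*) where
  graph : SimpleGraph V
  connected : graph.Connected
  cond : V → V → ℝ
  cond_nonneg : ∀ x y, 0 ≤ cond x y
  cond_symm : ∀ x y, cond x y = cond y x
  cond_pos_iff : ∀ x y, 0 < cond x y ↔ graph.Adj x y
  summable_cond : ∀ x, Summable (cond x)

namespace ElectricalNetwork

variable {V : Type*} (G : ElectricalNetwork V)

/-! ### The resistance form of a network and recurrence -/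

/-- The total conductance `c(x) = ∑ y, c(x, y)`. -/
noncomputable def totalCond (x : V) : ℝ := ∑' y, G.cond x y

/-- `f ∈ 𝓕`: the function `f` has finite energy. -/
def FiniteEnergy (f : V → ℝ) : Prop :=
  Summable fun p : V × V => G.cond p.1 p.2 * (f p.1 - f p.2) ^ 2

/-- The form `𝓔(f, g) = ½ ∑_{x, y} c(x, y) (f(x) - f(y)) (g(x) - g(y))`; the series converges
absolutely if `f` and `g` have finite energy. -/
noncomputable def energy (f g : V → ℝ) : ℝ :=
  (1 / 2) * ∑' p : V × V, G.cond p.1 p.2 * (f p.1 - f p.2) * (g p.1 - g p.2)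

/-- The resistance metric
`R(x, y) = sup {|f(x) - f(y)|² / 𝓔(f, f) : f ∈ 𝓕, 𝓔(f, f) > 0}`. -/
noncomputable def resistance (x y : V) : ℝ≥0∞ :=
  ⨆ (f : V → ℝ) (_ : G.FiniteEnergy f ∧ 0 < G.energy f f),
    ENNReal.ofReal (|f x - f y| ^ 2 / G.energy f f)

/-- The open ball of radius `r` around `x` for the resistance metric. -/
def resistanceBall (x : V) (r : ℝ) : Set V :=
  {y | G.resistance x y < ENNReal.ofReal r}

/-- The effective resistance between two sets,
`R(A, B) = (inf {𝓔(f, f) : f ∈ 𝓕, f = 1 on A, f = 0 on B})⁻¹`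
(zero if there is no such `f`, infinite if the infimum is zero). -/
noncomputable def setResistance (A B : Set V) : ℝ≥0∞ :=
  (⨅ (f : V → ℝ) (_ : G.FiniteEnergy f ∧ (∀ x ∈ A, f x = 1) ∧ (∀ x ∈ B, f x = 0)),
    ENNReal.ofReal (G.energy f f))⁻¹

/-- Bounded sets of the resistance metric are relatively compact. The topology of the
resistance metric of a network is discrete, so that this says that balls are finite. -/
def BoundedlyCompact : Prop :=
  ∀ (x : V) (r : ℝ), (G.resistanceBall x r).Finite

/-- The resistance form of the network is recurrent: `R(x, B(x, r)ᶜ) → ∞` as `r → ∞`, for some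
(equivalently, any) vertex `x`. -/
def Recurrent : Prop :=
  ∃ x : V, Tendsto (fun r : ℝ => G.setResistance {x} (G.resistanceBall x r)ᶜ) atTop (𝓝 ∞)

/-! ### The trace of a network on a set of vertices -/

/-- `u ∈ 𝓕⁽¹⁾`: the function `u` is in the closure of the finitely supported functions (the
compactly supported ones, as the topology is discrete) of finite energy for the inner product
`𝓔(u, v) + u(x₀) v(x₀)`. The choice of `x₀` does not matter. -/
def MemClosure (u : V → ℝ) : Prop :=
  G.FiniteEnergy u ∧ ∀ x₀ : V, ∀ ε > 0, ∃ v : V → ℝ,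
    (Function.support v).Finite ∧ G.FiniteEnergy v ∧
      G.energy (u - v) (u - v) + (u x₀ - v x₀) ^ 2 < ε

/-- `u` minimizes the energy among the functions in `𝓕⁽¹⁾` that are equal to `φ` on `B`. -/
def IsEnergyMinimizer (B : Set V) (φ : B → ℝ) (u : V → ℝ) : Prop :=
  (G.MemClosure u ∧ ∀ b : B, u b = φ b) ∧
    ∀ w : V → ℝ, (G.MemClosure w ∧ ∀ b : B, w b = φ b) → G.energy u u ≤ G.energy w w

open Classical in
/-- The harmonic extension of `φ : B → ℝ`: the energy minimizer with boundary value `φ`, which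
exists and is unique as soon as `φ` is the restriction of a function in `𝓕⁽¹⁾` and `B` is
non-empty (and `0` if there is none). -/
noncomputable def harmonicExtension (B : Set V) (φ : B → ℝ) : V → ℝ :=
  if h : ∃ u, G.IsEnergyMinimizer B φ u then h.choose else 0

/-- The trace of the resistance form on `B`. -/
noncomputable def traceEnergy (B : Set V) (φ ψ : B → ℝ) : ℝ :=
  G.energy (G.harmonicExtension B φ) (G.harmonicExtension B ψ)

open Classical in
/-- The conductances of the trace network: `-𝓔|_B(1_{x}, 1_{y})` for `x ≠ y`, and `0` for
`x = y`. -/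
noncomputable def traceCond (B : Set V) (x y : B) : ℝ :=
  if x = y then 0 else
    -G.traceEnergy B (Set.indicator {x} fun _ => 1) (Set.indicator {y} fun _ => 1)

/-- `H` is the trace of `G` on `B`: its vertex set is `B` and its conductances are the trace
conductances (which determine the edges of `H`). -/
def IsTrace (B : Set V) (H : ElectricalNetwork B) : Prop :=
  ∀ x y : B, H.cond x y = G.traceCond B x y

/-! ### The discrete-time Markov chain of a network -/

open Classical in
/-- The transition probabilities `P(x, y) = c(x, y) / c(x)`. If `c(x) = 0`, which happens only
if `x` is the only vertex, then the chain stays at `x`. -/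
noncomputable def transProb (x y : V) : ℝ :=
  if G.totalCond x = 0 then (if x = y then 1 else 0) else G.cond x y / G.totalCond x

lemma transProb_nonneg (x y : V) : 0 ≤ G.transProb x y := by
  unfold transProb
  split_ifs
  · exact zero_le_one
  · exact le_rfl
  · exact div_nonneg (G.cond_nonneg x y) (tsum_nonneg (G.cond_nonneg x))

lemma hasSum_transProb (x : V) : HasSum (G.transProb x) 1 := by
  classical
  by_cases h : G.totalCond x = 0
  · have : G.transProb x = fun y => if y = x then 1 else 0 := by
      funext y
      simp [transProb, h, eq_comm]
    rw [this]
    exact hasSum_ite_eq x 1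
  · have : G.transProb x = fun y => G.cond x y / G.totalCond x := by
      funext y
      simp [transProb, h]
    rw [this, ← div_self h]
    exact (G.summable_cond x).hasSum.div_const _

/-- The distribution of a step of the chain from `x`. -/
noncomputable def stepPMF (x : V) : PMF V :=
  ⟨fun y => ENNReal.ofReal (G.transProb x y), by
    have h := (ENNReal.ofReal_tsum_of_nonneg (G.transProb_nonneg x)
      (G.hasSum_transProb x).summable)
    rw [(G.hasSum_transProb x).tsum_eq, ENNReal.ofReal_one] at h
    rw [h]
    exact ENNReal.summable.hasSum⟩

variable [Countable V] [MeasurableSpace V] [DiscreteMeasurableSpace V]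

/-- The transition kernel of the chain. -/
noncomputable def stepKernel : Kernel V V :=
  ⟨fun x => (G.stepPMF x).toMeasure, measurable_of_countable _⟩

instance : IsMarkovKernel G.stepKernel :=
  ⟨fun x => inferInstanceAs (IsProbabilityMeasure (G.stepPMF x).toMeasure)⟩

/-- The conditional distribution of the position at time `n + 1`, given the positions up to
time `n`. -/
noncomputable def nextKernel (n : ℕ) : Kernel ((_ : Finset.Iic n) → V) V :=
  G.stepKernel.comap (fun h => h ⟨n, Finset.mem_Iic.2 le_rfl⟩) (measurable_pi_apply _)

instance (n : ℕ) : IsMarkovKernel (G.nextKernel n) :=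
  inferInstanceAs (IsMarkovKernel (G.stepKernel.comap _ _))

/-- The law, on the space of sequences of vertices, of the discrete-time Markov chain on `G`
started at `ρ`. -/
noncomputable def chainLaw (ρ : V) : Measure (ℕ → V) :=
  Kernel.traj (X := fun _ => V) G.nextKernel 0 fun _ => ρ

end ElectricalNetwork

/-! ### The trace of a sequence on a set -/

open Classical in
/-- The successive times of the visits to new points of `B`: `T₀ = 0`, and `T_{k+1}` is the first
time `n > T_k` at which the sequence is in `B`, but not at its position at time `T_k`
(`T_{k+1} = T_k` if there is no such `n`). -/
noncomputable def traceTime {V : Type*} (B : Set V) (p : ℕ → V) : ℕ → ℕ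
  | 0 => 0
  | k + 1 =>
    if ∃ n, traceTime B p k + 1 ≤ n ∧ p n ∈ B \ {p (traceTime B p k)} then
      sInf {n | traceTime B p k + 1 ≤ n ∧ p n ∈ B \ {p (traceTime B p k)}}
    else traceTime B p k

open Classical in
/-- The trace on `B` of a sequence, as a sequence in `B`. The value `ρ` is a default that is used
only for sequences that do not start in `B`. -/
noncomputable def traceSeq {V : Type*} (B : Set V) (ρ : B) (p : ℕ → V) (k : ℕ) : B :=
  if h : p (traceTime B p k) ∈ B then ⟨p (traceTime B p k), h⟩ else ρ

/-! ### The Skorokhod space -/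

/-- The space `D(ℝ₊, E)` of right-continuous functions `ℝ₊ → E` with left limits. -/
def Cadlag (E : Type*) [TopologicalSpace E] : Type _ :=
  {x : ℝ≥0 → E // (∀ t, ContinuousWithinAt x (Set.Ici t) t) ∧
    ∀ t, ∃ l, Tendsto x (𝓝[<] t) (𝓝 l)}

namespace Cadlag

variable {E : Type*} [MetricSpace E]

/-- The basic neighbourhoods of `x` in the J₁ topology: the paths that are, on `[0, T]`,
uniformly `ε`-close to `x` up to a change of time that is uniformly `ε`-close to the identity
on `[0, T]`. -/
def basicNhd (x : Cadlag E) (T : ℝ≥0) (ε : ℝ) : Set (Cadlag E) :=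
  {y | ∃ l : ℝ≥0 ≃o ℝ≥0, ∀ t ≤ T, dist (l t) t < ε ∧ dist (y.1 t) (x.1 (l t)) < ε}

/-- Skorokhod's J₁ topology. -/
instance : TopologicalSpace (Cadlag E) where
  IsOpen O := ∀ x ∈ O, ∃ T : ℝ≥0, ∃ ε > 0, basicNhd x T ε ⊆ O
  isOpen_univ := fun _ _ => ⟨0, 1, one_pos, Set.subset_univ _⟩
  isOpen_inter := by
    intro O O' hO hO' x hx
    obtain ⟨T, ε, hε, h⟩ := hO x hx.1
    obtain ⟨T', ε', hε', h'⟩ := hO' x hx.2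
    refine ⟨max T T', min ε ε', lt_min hε hε', ?_⟩
    rintro y ⟨l, hl⟩
    exact ⟨h ⟨l, fun t ht => ⟨(hl t (le_max_of_le_left ht)).1.trans_le (min_le_left _ _),
        (hl t (le_max_of_le_left ht)).2.trans_le (min_le_left _ _)⟩⟩,
      h' ⟨l, fun t ht => ⟨(hl t (le_max_of_le_right ht)).1.trans_le (min_le_right _ _),
        (hl t (le_max_of_le_right ht)).2.trans_le (min_le_right _ _)⟩⟩⟩
  isOpen_sUnion := by
    rintro S hS x ⟨O, hO, hx⟩
    obtain ⟨T, ε, hε, h⟩ := hS O hO x hx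
    exact ⟨T, ε, hε, h.trans (Set.subset_sUnion_of_mem hO)⟩

/-- The Borel σ-algebra of the J₁ topology. -/
instance : MeasurableSpace (Cadlag E) := borel _

instance : BorelSpace (Cadlag E) := ⟨rfl⟩

/-- A sequence `q`, as the path `t ↦ q ⌊t⌋`. -/
noncomputable def ofSeq (q : ℕ → E) : Cadlag E :=
  ⟨fun t => q ⌊t⌋₊, by
    constructor
    · intro t
      refine tendsto_nhds_of_eventually_eq ?_
      have h : Set.Iio ((⌊t⌋₊ : ℝ≥0) + 1) ∈ 𝓝 t := Iio_mem_nhds (Nat.lt_floor_add_one t)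
      filter_upwards [mem_nhdsWithin_of_mem_nhds h, self_mem_nhdsWithin] with s hs hts
      have h1 : ⌊s⌋₊ = ⌊t⌋₊ :=
        le_antisymm (Nat.lt_succ_iff.1 ((Nat.floor_lt' (Nat.succ_ne_zero _)).2 (by
          push_cast; exact hs))) (Nat.floor_mono hts)
      rw [h1]
    · intro t
      refine ⟨q (⌈t⌉₊ - 1), tendsto_nhds_of_eventually_eq ?_⟩
      rcases eq_or_ne t 0 with rfl | ht
      · filter_upwards [self_mem_nhdsWithin] with s hs
        exact absurd (Set.mem_Iio.1 hs) not_lt_zero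
      · have h0 : 0 < ⌈t⌉₊ := Nat.ceil_pos.2 (pos_iff_ne_zero.2 ht)
        have h1 : ((⌈t⌉₊ - 1 : ℕ) : ℝ≥0) < t := Nat.lt_ceil.1 (Nat.sub_lt h0 one_pos)
        filter_upwards [mem_nhdsWithin_of_mem_nhds (Ioi_mem_nhds h1), self_mem_nhdsWithin]
          with s hs hst
        have h2 : ⌊s⌋₊ = ⌈t⌉₊ - 1 := by
          refine le_antisymm ?_ (Nat.le_floor (le_of_lt hs))
          have h3 : ⌊s⌋₊ < ⌈t⌉₊ :=
            Nat.lt_ceil.2 ((Nat.floor_le (zero_le)).trans_lt hst)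
          omega
        rw [h2]⟩

/-- `ofSeq` is measurable, so that a random sequence in a countable discrete space is a random
element of `D(ℝ₊, E)`. -/
lemma measurable_ofSeq [Countable E] [DiscreteTopology E] [MeasurableSpace E]
    [DiscreteMeasurableSpace E] : Measurable (ofSeq : (ℕ → E) → Cadlag E) := by
  have : OpensMeasurableSpace E := ⟨fun _ _ => MeasurableSet.of_discrete⟩
  refine Continuous.measurable ⟨fun O hO => ?_⟩
  rw [isOpen_iff_mem_nhds]
  intro q hq
  obtain ⟨T, ε, hε, h⟩ := hO _ hq
  have hS : (Set.Iic ⌊T⌋₊).pi (fun i => {q i}) ∈ 𝓝 q :=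
    set_pi_mem_nhds (Set.finite_Iic _) fun i _ => (isOpen_discrete _).mem_nhds rfl
  filter_upwards [hS] with p hp
  refine h ⟨OrderIso.refl _, fun t ht => ?_⟩
  have : p ⌊t⌋₊ = q ⌊t⌋₊ := hp _ (Nat.floor_mono ht)
  simp [ofSeq, this, hε]

end Cadlag

lemma measurable_traceTime {V : Type*} [Countable V] [MeasurableSpace V]
    [DiscreteMeasurableSpace V] (B : Set V) (k : ℕ) :
    Measurable fun p : ℕ → V => traceTime B p k := by
  classical
  have hset : ∀ t n : ℕ, MeasurableSet {p : ℕ → V | t + 1 ≤ n ∧ p n ∈ B \ {p t}} := by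
    intro t n
    have h : Measurable fun p : ℕ → V => (p t, p n) :=
      (measurable_pi_apply t).prodMk (measurable_pi_apply n)
    exact (MeasurableSet.const _).inter
      (h (MeasurableSet.of_discrete (s := {z : V × V | z.2 ∈ B \ {z.1}})))
  induction k with
  | zero => exact measurable_const
  | succ k ih =>
    have hF : ∀ t : ℕ, Measurable fun p : ℕ → V =>
        if ∃ n, t + 1 ≤ n ∧ p n ∈ B \ {p t} then
          sInf {n | t + 1 ≤ n ∧ p n ∈ B \ {p t}} else t := by
      intro t
      have hex : MeasurableSet {p : ℕ → V | ∃ n, t + 1 ≤ n ∧ p n ∈ B \ {p t}} := by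
        rw [Set.ofPred_exists]
        exact MeasurableSet.iUnion (hset t)
      have hne : ∀ p : ℕ → V, ∃ n, (¬ ∃ n, t + 1 ≤ n ∧ p n ∈ B \ {p t}) ∨
          (t + 1 ≤ n ∧ p n ∈ B \ {p t}) := by
        intro p
        by_cases h : ∃ n, t + 1 ≤ n ∧ p n ∈ B \ {p t}
        · exact ⟨h.choose, Or.inr h.choose_spec⟩
        · exact ⟨0, Or.inl h⟩
      have hfind := measurable_find hne fun n => hex.compl.union (hset t n)
      have hfe : ∀ p : ℕ → V, (∃ n, t + 1 ≤ n ∧ p n ∈ B \ {p t}) →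
          sInf {n | t + 1 ≤ n ∧ p n ∈ B \ {p t}} = Nat.find (hne p) := fun p h =>
        ((Nat.find_eq_iff (hne p)).2 ⟨Or.inr (Nat.sInf_mem h), fun n hn hn' =>
          Or.elim hn' (fun h' => h' h) (Nat.notMem_of_lt_sInf hn)⟩).symm
      have heq : (fun p : ℕ → V => if ∃ n, t + 1 ≤ n ∧ p n ∈ B \ {p t} then
          sInf {n | t + 1 ≤ n ∧ p n ∈ B \ {p t}} else t) =
          fun p => if ∃ n, t + 1 ≤ n ∧ p n ∈ B \ {p t} then Nat.find (hne p) else t := by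
        funext p
        by_cases h : ∃ n, t + 1 ≤ n ∧ p n ∈ B \ {p t}
        · rw [if_pos h, if_pos h, hfe p h]
        · rw [if_neg h, if_neg h]
      rw [heq]
      exact hfind.ite hex measurable_const
    have h2 : Measurable fun z : ℕ × (ℕ → V) =>
        if ∃ n, z.1 + 1 ≤ n ∧ z.2 n ∈ B \ {z.2 z.1} then
          sInf {n | z.1 + 1 ≤ n ∧ z.2 n ∈ B \ {z.2 z.1}} else z.1 :=
      measurable_from_prod_countable_right hF
    exact h2.comp (ih.prodMk measurable_id)

/-- The trace of a random sequence is a random sequence. -/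
lemma measurable_traceSeq {V : Type*} [Countable V] [MeasurableSpace V]
    [DiscreteMeasurableSpace V] (B : Set V) (ρ : B) : Measurable (traceSeq B ρ) := by
  classical
  refine measurable_pi_lambda _ fun k => ?_
  have h : Measurable fun z : ℕ × (ℕ → V) => z.2 z.1 :=
    measurable_from_prod_countable_right fun t => measurable_pi_apply t
  have h1 : Measurable fun p : ℕ → V => p (traceTime B p k) :=
    h.comp ((measurable_traceTime B k).prodMk measurable_id)
  have h2 : Measurable fun v : V => if h : v ∈ B then (⟨v, h⟩ : B) else ρ :=
    measurable_of_countable _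
  exact h2.comp h1

/-! The proof is potential theory resting on one uniqueness principle. Recurrence and finiteness of
balls give finitely supported cut-offs with values in `[0, 1]`, energy tending to `0` and pointwise
limit `1` (`exists_isCutoff`). They place every bounded function of finite energy in `𝓕⁽¹⁾`, and
they force bounded superharmonic functions to be constant. Hence a bounded function that is harmonic
off a non-empty set and vanishes on that set is zero (`IsCutoff.eq_zero_of_harmonic`).

Let `h_x` be the harmonic extension of the indicator of `x ∈ B`, and `Δ` the Laplacian. Then `Δ h_x
= 0` off `B` and `𝓔(h_x, h_y) = Δ h_x (y)`. Fix `y ∈ B` and let `g(z)` be the probability that the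
chain from `z` enters `B \ {y}` at `x`. It is harmonic off `B \ {y}`, so uniqueness gives `g = h_x +
g(y) h_y`. Applying `Δ` at `y` yields `c(y, x) = g(y) 𝓔(h_y, h_y)` for the trace conductance
(`IsCutoff.traceCond_eq_mul`). By uniqueness again, the chain enters `B \ {y}` almost surely
whenever this set is non-empty. Summing over `x` shows that `y` has total trace conductance `𝓔(h_y,
h_y)`, so `g(y)` is the transition probability of the trace network from `y` to `x`.

Uniqueness also replaces stopping times: the strong Markov property at an entrance to `B \ {y}` is
an equality of two bounded harmonic functions with the same boundary values
(`IsCutoff.visitProb_cons`). Iterating it computes the probability that the chain visits prescribed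
points of `B` in order. This bounds the cylinder probabilities of the traced chain from below, which
suffices, as two comparable probability measures are equal (`Measure.ext_of_le_cylinder`). -/

namespace ElectricalNetwork

/-! ### Energy form, Laplacian and Green's formula -/

section Energy

variable {V : Type*} (G : ElectricalNetwork V)

lemma energy_self (f : V → ℝ) :
    G.energy f f = 1 / 2 * ∑' p : V × V, G.cond p.1 p.2 * (f p.1 - f p.2) ^ 2 := by
  unfold energy
  congr 1
  exact tsum_congr fun p => by ring

lemma energy_comm (f g : V → ℝ) : G.energy f g = G.energy g f := by
  unfold energy
  congr 1
  exact tsum_congr fun p => by ring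

lemma edge_nonneg (f : V → ℝ) (p : V × V) : 0 ≤ G.cond p.1 p.2 * (f p.1 - f p.2) ^ 2 :=
  mul_nonneg (G.cond_nonneg _ _) (sq_nonneg _)

lemma energy_self_nonneg (f : V → ℝ) : 0 ≤ G.energy f f := by
  rw [energy_self]
  exact mul_nonneg (by norm_num) (tsum_nonneg (G.edge_nonneg f))

lemma edge_le_energy {f : V → ℝ} (hf : G.FiniteEnergy f) (x y : V) :
    G.cond x y * (f x - f y) ^ 2 ≤ 2 * G.energy f f := by
  rw [energy_self]
  have := hf.le_tsum (x, y) fun _ _ => G.edge_nonneg f _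
  simp only at this
  linarith

variable {G}

lemma FiniteEnergy.of_contraction {f g : V → ℝ} (hf : G.FiniteEnergy f)
    (h : ∀ x y, |g x - g y| ≤ |f x - f y|) : G.FiniteEnergy g :=
  Summable.of_nonneg_of_le (G.edge_nonneg g)
    (fun _ => mul_le_mul_of_nonneg_left (sq_le_sq.2 (h _ _)) (G.cond_nonneg _ _)) hf

lemma FiniteEnergy.energy_le_of_contraction {f g : V → ℝ} (hf : G.FiniteEnergy f)
    (h : ∀ x y, |g x - g y| ≤ |f x - f y|) : G.energy g g ≤ G.energy f f := by
  rw [energy_self, energy_self]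
  exact mul_le_mul_of_nonneg_left ((hf.of_contraction h).tsum_le_tsum
    (fun p => mul_le_mul_of_nonneg_left (sq_le_sq.2 (h _ _)) (G.cond_nonneg _ _)) hf)
    (by norm_num)

lemma FiniteEnergy.summable_mul {f g : V → ℝ} (hf : G.FiniteEnergy f) (hg : G.FiniteEnergy g) :
    Summable fun p : V × V => G.cond p.1 p.2 * (f p.1 - f p.2) * (g p.1 - g p.2) := by
  refine Summable.of_norm_bounded (hf.add hg) fun p => ?_
  rw [Real.norm_eq_abs, mul_assoc, abs_mul, abs_of_nonneg (G.cond_nonneg _ _), ← mul_add]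
  refine mul_le_mul_of_nonneg_left ?_ (G.cond_nonneg _ _)
  rw [abs_le]
  constructor <;> nlinarith [sq_nonneg ((f p.1 - f p.2) + (g p.1 - g p.2)),
    sq_nonneg ((f p.1 - f p.2) - (g p.1 - g p.2))]

lemma FiniteEnergy.add_smul {f g : V → ℝ} (hf : G.FiniteEnergy f) (hg : G.FiniteEnergy g)
    (t : ℝ) : G.FiniteEnergy (fun x => f x + t * g x) :=
  ((Summable.add hf ((hf.summable_mul hg).mul_left (2 * t))).add (hg.mul_left (t ^ 2))).congr
    fun p => by ring

lemma FiniteEnergy.energy_add_smul {f g : V → ℝ} (hf : G.FiniteEnergy f)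
    (hg : G.FiniteEnergy g) (t : ℝ) :
    G.energy (fun x => f x + t * g x) (fun x => f x + t * g x) =
      G.energy f f + 2 * t * G.energy f g + t ^ 2 * G.energy g g := by
  have h := (((show Summable _ from hf).hasSum.add
    ((hf.summable_mul hg).hasSum.mul_left (2 * t))).add (hg.hasSum.mul_left (t ^ 2))).tsum_eq
  rw [energy_self, energy_self, energy_self, energy]
  have h' : ∀ a b c : ℝ, 1 / 2 * a + 2 * t * (1 / 2 * b) + t ^ 2 * (1 / 2 * c) =
      1 / 2 * (a + 2 * t * b + t ^ 2 * c) := fun a b c => by ring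
  rw [h', ← h]
  congr 1
  exact tsum_congr fun p => by ring

lemma FiniteEnergy.energy_sub_right {f g h : V → ℝ} (hf : G.FiniteEnergy f)
    (hg : G.FiniteEnergy g) (hh : G.FiniteEnergy h) :
    G.energy f (fun x => g x - h x) = G.energy f g - G.energy f h := by
  unfold energy
  rw [← mul_sub, ← ((hf.summable_mul hg).hasSum.sub (hf.summable_mul hh).hasSum).tsum_eq]
  congr 1
  exact tsum_congr fun p => by ring

lemma FiniteEnergy.sub {f g : V → ℝ} (hf : G.FiniteEnergy f) (hg : G.FiniteEnergy g) :
    G.FiniteEnergy (fun x => f x - g x) :=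
  (hf.add_smul hg (-1)).of_contraction fun x y => le_of_eq (by congr 1; ring)

variable (G)

/-- The double series is a finite sum of rows, one for each point of the support of `ψ`, and each
row is dominated by a multiple of the summable conductances there. -/
lemma summable_cond_mul {ψ : V → ℝ} (hψ : (Function.support ψ).Finite) {g : V × V → ℝ} {K : ℝ}
    (hg : ∀ p, |g p| ≤ K) : Summable fun p : V × V => G.cond p.1 p.2 * g p * ψ p.1 := by
  classical
  have h : (fun p : V × V => G.cond p.1 p.2 * g p * ψ p.1) =
      fun p => ∑ z ∈ hψ.toFinset, if p.1 = z then G.cond z p.2 * g (z, p.2) * ψ z else 0 := by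
    funext p
    rw [Finset.sum_ite_eq hψ.toFinset p.1]
    split_ifs with hp
    · rfl
    · rw [Set.Finite.mem_toFinset, Function.notMem_support] at hp
      rw [hp, mul_zero]
  rw [h]
  refine summable_sum fun z _ => ?_
  refine (Function.Injective.summable_iff (Prod.mk_right_injective z) ?_).1 ?_
  · rintro ⟨a, b⟩ hab
    refine if_neg fun h => hab ⟨b, ?_⟩
    simp only at h
    rw [h]
  · simp only [Function.comp_def, if_true]
    refine Summable.mul_right _ (Summable.of_norm_bounded ((G.summable_cond z).mul_right K)
      fun y => ?_)
    rw [Real.norm_eq_abs, abs_mul, abs_of_nonneg (G.cond_nonneg _ _)]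
    exact mul_le_mul_of_nonneg_left (hg _) (G.cond_nonneg _ _)

/-- The (unnormalized, positive) Laplacian of the network. -/
noncomputable def laplacian (u : V → ℝ) (z : V) : ℝ := ∑' y, G.cond z y * (u z - u y)

lemma summable_cond_mul_row {u : V → ℝ} {K : ℝ} (hu : ∀ x, |u x| ≤ K) (z : V) :
    Summable fun y => G.cond z y * u y := by
  refine Summable.of_norm_bounded ((G.summable_cond z).mul_right K) fun y => ?_
  rw [Real.norm_eq_abs, abs_mul, abs_of_nonneg (G.cond_nonneg _ _)]
  exact mul_le_mul_of_nonneg_left (hu y) (G.cond_nonneg _ _)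

lemma laplacian_eq {u : V → ℝ} {K : ℝ} (hu : ∀ x, |u x| ≤ K) (z : V) :
    G.laplacian u z = G.totalCond z * u z - ∑' y, G.cond z y * u y := by
  rw [laplacian, totalCond, ← tsum_mul_right,
    ← ((G.summable_cond z).mul_right (u z)).tsum_sub (G.summable_cond_mul_row hu z)]
  exact tsum_congr fun y => mul_sub _ _ _

lemma laplacian_sub {u v : V → ℝ} {K L : ℝ} (hu : ∀ x, |u x| ≤ K) (hv : ∀ x, |v x| ≤ L) (z : V) :
    G.laplacian (fun x => u x - v x) z = G.laplacian u z - G.laplacian v z := by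
  rw [G.laplacian_eq (K := K + L) fun x => (abs_sub _ _).trans (add_le_add (hu x) (hv x)),
    G.laplacian_eq hu, G.laplacian_eq hv, sub_sub_sub_comm, ← mul_sub,
    ← (G.summable_cond_mul_row hu z).tsum_sub (G.summable_cond_mul_row hv z)]
  congr 1
  exact tsum_congr fun y => mul_sub _ _ _

lemma laplacian_const_mul (a : ℝ) (u : V → ℝ) (z : V) :
    G.laplacian (fun x => a * u x) z = a * G.laplacian u z := by
  rw [laplacian, laplacian, ← tsum_mul_left]
  exact tsum_congr fun y => by ring

variable {G} in
lemma abs_sub_le_of_bounded {u : V → ℝ} {K : ℝ} (hu : ∀ x, |u x| ≤ K) (p : V × V) :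
    |u p.1 - u p.2| ≤ K + K :=
  (abs_sub _ _).trans (add_le_add (hu _) (hu _))

/-- Green's formula: split `ψ p.1 - ψ p.2`; the two halves agree by symmetry of the conductances,
whence the factor `2`. Boundedness of `u` replaces finite energy, so the formula applies to hitting
probabilities. -/
lemma energy_hasSum_of_finite_support {u ψ : V → ℝ} {K : ℝ} (hu : ∀ x, |u x| ≤ K)
    (hψ : (Function.support ψ).Finite) :
    HasSum (fun p : V × V => G.cond p.1 p.2 * (u p.1 - u p.2) * (ψ p.1 - ψ p.2))
      (2 * ∑' z, ψ z * G.laplacian u z) := by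
  have h1 := G.summable_cond_mul hψ (abs_sub_le_of_bounded hu)
  have h2 : HasSum (fun p : V × V => G.cond p.1 p.2 * (u p.1 - u p.2) * ψ p.1)
      (∑' z, ψ z * G.laplacian u z) := by
    convert h1.hasSum using 1
    rw [h1.tsum_prod]
    refine tsum_congr fun z => ?_
    simp only
    rw [tsum_mul_right, mul_comm, laplacian]
  have h3 := (Equiv.prodComm V V).hasSum_iff.2 h2
  convert h2.add h3 using 1
  · funext p
    simp only [Function.comp, Equiv.prodComm_apply, Prod.fst_swap, Prod.snd_swap]
    rw [G.cond_symm p.2 p.1]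
    ring
  · ring

lemma energy_of_finite_support {u ψ : V → ℝ} {K : ℝ} (hu : ∀ x, |u x| ≤ K)
    (hψ : (Function.support ψ).Finite) : G.energy u ψ = ∑' z, ψ z * G.laplacian u z := by
  rw [energy, (G.energy_hasSum_of_finite_support hu hψ).tsum_eq]
  ring

lemma bounded_of_finite_support {ψ : V → ℝ} (hψ : (Function.support ψ).Finite) :
    ∃ K, ∀ x, |ψ x| ≤ K := by
  obtain ⟨K, hK⟩ := (hψ.image fun x => |ψ x|).bddAbove
  refine ⟨max K 0, fun x => ?_⟩
  by_cases hx : ψ x = 0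
  · simp [hx]
  · exact le_max_of_le_left (hK ⟨x, hx, rfl⟩)

lemma finiteEnergy_of_finite_support {ψ : V → ℝ} (hψ : (Function.support ψ).Finite) :
    G.FiniteEnergy ψ := by
  obtain ⟨K, hK⟩ := bounded_of_finite_support hψ
  exact (G.energy_hasSum_of_finite_support hK hψ).summable.congr fun p => by ring

/-! ### Recurrence and cut-off functions -/

variable {G} in
lemma tendsto_of_adj {f : ℕ → V → ℝ} (hf : ∀ n, G.FiniteEnergy (f n))
    (hE : Tendsto (fun n => G.energy (f n) (f n)) atTop (𝓝 0)) {x y : V} (hxy : G.graph.Adj x y)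
    (hx : Tendsto (fun n => f n x) atTop (𝓝 1)) : Tendsto (fun n => f n y) atTop (𝓝 1) := by
  have hc := (G.cond_pos_iff x y).2 hxy
  have h1 : Tendsto (fun n => (f n x - f n y) ^ 2) atTop (𝓝 0) := by
    have h2 : Tendsto (fun n => 2 * G.energy (f n) (f n) / G.cond x y) atTop (𝓝 0) := by
      simpa using (hE.const_mul 2).div_const (G.cond x y)
    refine squeeze_zero (fun n => sq_nonneg _) (fun n => ?_) h2
    rw [le_div_iff₀ hc, mul_comm]
    exact G.edge_le_energy (hf n) x y
  have h3 : Tendsto (fun n => f n x - f n y) atTop (𝓝 0) := by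
    have h4 : Tendsto (fun n => Real.sqrt ((f n x - f n y) ^ 2)) atTop (𝓝 0) := by
      simpa using h1.sqrt
    simp only [Real.sqrt_sq_eq_abs] at h4
    exact (tendsto_zero_iff_abs_tendsto_zero _).2 h4
  simpa using hx.sub h3

/-- A sequence of cut-off functions showing that the network is recurrent. -/
structure IsCutoff (f : ℕ → V → ℝ) : Prop where
  finite_support : ∀ n, (Function.support (f n)).Finite
  nonneg : ∀ n x, 0 ≤ f n x
  le_one : ∀ n x, f n x ≤ 1
  tendsto_energy : Tendsto (fun n => G.energy (f n) (f n)) atTop (𝓝 0)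
  tendsto_one : ∀ x, Tendsto (fun n => f n x) atTop (𝓝 1)

/-- Truncation of a real number to the unit interval. -/
def truncate (t : ℝ) : ℝ := max (min t 1) 0

lemma truncate_nonneg (t : ℝ) : 0 ≤ truncate t := le_max_right _ _

lemma truncate_le_one (t : ℝ) : truncate t ≤ 1 := max_le (min_le_right _ _) zero_le_one

lemma truncate_of_mem {t : ℝ} (h0 : 0 ≤ t) (h1 : t ≤ 1) : truncate t = t := by
  rw [truncate, min_eq_left h1, max_eq_left h0]

lemma abs_truncate_sub_le (s t : ℝ) : |truncate s - truncate t| ≤ |s - t| :=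
  (abs_max_sub_max_le_abs _ _ _).trans
    ((abs_min_sub_min_le_max _ _ _ _).trans (by simp))

/-- A resistance above `n + 1` to the complement of a ball provides a function of energy below `1 /
(n + 1)` that is `1` at `x` and `0` off the ball. Truncation does not increase its energy, and its
support is finite because the ball is. Convergence to `1` spreads from `x` along edges, since a
single edge controls the squared increment by the energy. -/
lemma exists_isCutoff (hG : G.BoundedlyCompact) (hrec : G.Recurrent) : ∃ f, G.IsCutoff f := by
  obtain ⟨x, hx⟩ := hrec
  have key : ∀ n : ℕ, ∃ f : V → ℝ, (Function.support f).Finite ∧ (∀ y, 0 ≤ f y) ∧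
      (∀ y, f y ≤ 1) ∧ f x = 1 ∧ G.energy f f ≤ 1 / (n + 1) := by
    intro n
    obtain ⟨r, hr⟩ := (hx.eventually (lt_mem_nhds
      (ENNReal.natCast_lt_top (n + 1)))).exists
    rw [setResistance, ENNReal.lt_inv_iff_lt_inv] at hr
    simp only [iInf_lt_iff] at hr
    obtain ⟨f, ⟨hf, hfx, hfb⟩, hfE⟩ := hr
    have hc : ∀ y z, |truncate (f y) - truncate (f z)| ≤ |f y - f z| :=
      fun y z => abs_truncate_sub_le _ _
    refine ⟨fun y => truncate (f y), (hG x r).subset fun y hy => ?_, fun _ => truncate_nonneg _,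
      fun _ => truncate_le_one _, ?_, (hf.energy_le_of_contraction hc).trans ?_⟩
    · by_contra hyr
      refine hy ?_
      simp only
      rw [hfb y hyr, truncate_of_mem le_rfl zero_le_one]
    · simp only
      rw [hfx x rfl, truncate_of_mem zero_le_one le_rfl]
    · have h1 : ((n + 1 : ℕ) : ℝ≥0∞)⁻¹ = ENNReal.ofReal (1 / (n + 1)) := by
        rw [one_div, ENNReal.ofReal_inv_of_pos (by positivity)]
        congr 1
        rw [← Nat.cast_succ, ENNReal.ofReal_natCast]
      rw [h1, ENNReal.ofReal_lt_ofReal_iff (by positivity)] at hfE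
      exact hfE.le
  choose f hf h0 h1 hfx hE using key
  have hEt : Tendsto (fun n => G.energy (f n) (f n)) atTop (𝓝 0) :=
    squeeze_zero (fun n => G.energy_self_nonneg _) hE tendsto_one_div_add_atTop_nhds_zero_nat
  refine ⟨f, hf, h0, h1, hEt, fun y => ?_⟩
  obtain ⟨w⟩ := G.connected.preconnected x y
  have hw : ∀ {a b : V} (_ : G.graph.Walk a b), Tendsto (fun n => f n a) atTop (𝓝 1) →
      Tendsto (fun n => f n b) atTop (𝓝 1) := by
    intro a b w
    induction w with
    | nil => exact id
    | cons h _ ih => exact fun ha => ih (tendsto_of_adj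
        (fun n => G.finiteEnergy_of_finite_support (hf n)) hEt h ha)
  exact hw w (by simp [hfx])

variable {G}

lemma IsCutoff.finiteEnergy {f : ℕ → V → ℝ} (hf : G.IsCutoff f) (n : ℕ) :
    G.FiniteEnergy (f n) :=
  G.finiteEnergy_of_finite_support (hf.finite_support n)

/-- A bounded function of finite energy can be approximated by its products with the cut-off
functions. -/
lemma IsCutoff.memClosure {f : ℕ → V → ℝ} (hf : G.IsCutoff f) {u : V → ℝ} {K : ℝ}
    (hu : ∀ x, |u x| ≤ K) (huE : G.FiniteEnergy u) : G.MemClosure u := by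
  refine ⟨huE, fun x₀ ε hε => ?_⟩
  have hfin : ∀ n, (Function.support fun x => f n x * u x).Finite := fun n =>
    (hf.finite_support n).subset fun x hx h => hx (by simp only [h, zero_mul])
  -- The increments of `(1 - f n) u` split by the product rule. The part with increments of `u`
  -- vanishes by dominated convergence, the part with increments of `f n` because the energy of `f
  -- n` does.
  have hbd : ∀ n, G.energy (u - fun x => f n x * u x) (u - fun x => f n x * u x) ≤
      (∑' p : V × V, (1 - f n p.1) ^ 2 * (G.cond p.1 p.2 * (u p.1 - u p.2) ^ 2)) +
        2 * K ^ 2 * G.energy (f n) (f n) := by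
    intro n
    have hs : Summable fun p : V × V =>
        (1 - f n p.1) ^ 2 * (G.cond p.1 p.2 * (u p.1 - u p.2) ^ 2) := by
      refine Summable.of_nonneg_of_le
        (fun p => mul_nonneg (sq_nonneg _) (G.edge_nonneg u p)) (fun p => ?_) huE
      refine mul_le_of_le_one_left (G.edge_nonneg u p) ?_
      nlinarith [hf.nonneg n p.1, hf.le_one n p.1]
    have hs2 := (hf.finiteEnergy n).mul_left (K ^ 2)
    have hle : ∀ p : V × V, G.cond p.1 p.2 *
        ((u - fun x => f n x * u x) p.1 - (u - fun x => f n x * u x) p.2) ^ 2 ≤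
        2 * ((1 - f n p.1) ^ 2 * (G.cond p.1 p.2 * (u p.1 - u p.2) ^ 2) +
          K ^ 2 * (G.cond p.1 p.2 * (f n p.1 - f n p.2) ^ 2)) := by
      intro p
      have h1 : (u p.2) ^ 2 * (f n p.1 - f n p.2) ^ 2 ≤ K ^ 2 * (f n p.1 - f n p.2) ^ 2 :=
        mul_le_mul_of_nonneg_right (sq_le_sq' (abs_le.1 (hu p.2)).1 (abs_le.1 (hu p.2)).2)
          (sq_nonneg _)
      have h2 : ((u - fun x => f n x * u x) p.1 - (u - fun x => f n x * u x) p.2) ^ 2 ≤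
          2 * ((1 - f n p.1) ^ 2 * (u p.1 - u p.2) ^ 2 + K ^ 2 * (f n p.1 - f n p.2) ^ 2) := by
        simp only [Pi.sub_apply]
        have h3 : (u p.1 - f n p.1 * u p.1) - (u p.2 - f n p.2 * u p.2) =
            (1 - f n p.1) * (u p.1 - u p.2) - u p.2 * (f n p.1 - f n p.2) := by ring
        rw [h3]
        nlinarith [sq_nonneg ((1 - f n p.1) * (u p.1 - u p.2) + u p.2 * (f n p.1 - f n p.2))]
      calc _ ≤ _ := mul_le_mul_of_nonneg_left h2 (G.cond_nonneg _ _)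
        _ = _ := by ring
    have hsum := (hs.add hs2).mul_left 2
    have := (Summable.of_nonneg_of_le (G.edge_nonneg _) hle hsum).tsum_le_tsum hle hsum
    rw [tsum_mul_left, hs.tsum_add hs2, tsum_mul_left] at this
    rw [energy_self, energy_self]
    linarith
  have ht1 : Tendsto (fun n => ∑' p : V × V,
      (1 - f n p.1) ^ 2 * (G.cond p.1 p.2 * (u p.1 - u p.2) ^ 2)) atTop (𝓝 0) := by
    have := tendsto_tsum_of_dominated_convergence (𝓕 := atTop)
      (f := fun n (p : V × V) => (1 - f n p.1) ^ 2 * (G.cond p.1 p.2 * (u p.1 - u p.2) ^ 2))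
      (g := fun _ => (0 : ℝ)) huE (fun p => ?_) (Eventually.of_forall fun n p => ?_)
    · simpa using this
    · have := (((tendsto_const_nhds (x := (1 : ℝ))).sub (hf.tendsto_one p.1)).pow 2).mul_const
        (G.cond p.1 p.2 * (u p.1 - u p.2) ^ 2)
      simpa using this
    · rw [Real.norm_eq_abs, abs_of_nonneg (mul_nonneg (sq_nonneg _) (G.edge_nonneg u p))]
      refine mul_le_of_le_one_left (G.edge_nonneg u p) ?_
      nlinarith [hf.nonneg n p.1, hf.le_one n p.1]
  have ht2 : Tendsto (fun n => (u x₀ - f n x₀ * u x₀) ^ 2) atTop (𝓝 0) := by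
    have := ((tendsto_const_nhds (x := u x₀)).sub ((hf.tendsto_one x₀).mul_const (u x₀))).pow 2
    simpa using this
  have ht3 := (ht1.add (hf.tendsto_energy.const_mul (2 * K ^ 2))).add ht2
  simp only [mul_zero, add_zero] at ht3
  obtain ⟨n, hn⟩ := (ht3.eventually (gt_mem_nhds hε)).exists
  exact ⟨fun x => f n x * u x, hfin n, G.finiteEnergy_of_finite_support (hfin n),
    (add_le_add_left (hbd n) _).trans_lt hn⟩

/-! ### Liouville property and maximum principle -/

/-- Bounded positive superharmonic functions on a recurrent network are constant. -/
lemma IsCutoff.superharmonic_const {f : ℕ → V → ℝ} (hf : G.IsCutoff f) {s : V → ℝ} {K : ℝ}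
    (hs1 : ∀ x, 1 ≤ s x) (hsK : ∀ x, s x ≤ K) (hsup : ∀ z, 0 ≤ G.laplacian s z) (x y : V) :
    s x = s y := by
  have hs0 : ∀ x, 0 < s x := fun x => zero_lt_one.trans_le (hs1 x)
  have habs : ∀ x, |s x| ≤ K := fun x => by rw [abs_of_pos (hs0 x)]; exact hsK x
  have hadj : ∀ x y, G.graph.Adj x y → s x = s y := by
    intro x y hxy
    have hc := (G.cond_pos_iff x y).2 hxy
    -- Ground state transform: `W n` sums to `2 𝓔(f, f) - 2 ∑ (f² / s) Δ s` with `f = f n`. As `Δ s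
    -- ≥ 0`, each term is at most `2 𝓔(f, f)`, which tends to `0`; in the limit `f n → 1` this
    -- forces `1 / s x = 1 / s y`.
    let W : ℕ → V × V → ℝ := fun n p => G.cond p.1 p.2 *
      (s p.1 * s p.2 * (f n p.1 / s p.1 - f n p.2 / s p.2) ^ 2)
    have hW0 : ∀ n p, 0 ≤ W n p := fun n p => mul_nonneg (G.cond_nonneg _ _)
      (mul_nonneg (mul_pos (hs0 _) (hs0 _)).le (sq_nonneg _))
    have hWle : ∀ n, W n (x, y) ≤ 2 * G.energy (f n) (f n) := by
      intro n
      have hfin : (Function.support fun z => f n z ^ 2 / s z).Finite :=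
        (hf.finite_support n).subset fun z hz h => hz (by simp [h])
      have h1 := G.energy_hasSum_of_finite_support habs hfin
      have h2 : HasSum (W n) (2 * G.energy (f n) (f n) -
          2 * ∑' z, f n z ^ 2 / s z * G.laplacian s z) := by
        have h3 := (hf.finiteEnergy n).hasSum.sub h1
        have h4 : 2 * G.energy (f n) (f n) =
            ∑' p : V × V, G.cond p.1 p.2 * (f n p.1 - f n p.2) ^ 2 := by
          rw [energy_self]; ring
        rw [h4]
        refine h3.congr_fun fun p => ?_
        have := (hs0 p.1).ne'
        have := (hs0 p.2).ne'
        simp only [W]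
        field_simp
        ring
      refine (le_hasSum h2 (x, y) fun p _ => hW0 n p).trans ?_
      have : 0 ≤ ∑' z, f n z ^ 2 / s z * G.laplacian s z := tsum_nonneg fun z =>
        mul_nonneg (div_nonneg (sq_nonneg _) (hs0 z).le) (hsup z)
      linarith
    have hlim : Tendsto (fun n => W n (x, y)) atTop
        (𝓝 (G.cond x y * (s x * s y * (1 / s x - 1 / s y) ^ 2))) :=
      (((((hf.tendsto_one x).div_const _).sub ((hf.tendsto_one y).div_const _)).pow 2).const_mul
        _).const_mul _
    have hle := le_of_tendsto_of_tendsto' hlim (hf.tendsto_energy.const_mul 2) hWle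
    rw [mul_zero] at hle
    have h5 : (1 / s x - 1 / s y) ^ 2 ≤ 0 := by
      by_contra h
      exact absurd hle (not_le.2 (mul_pos hc (mul_pos (mul_pos (hs0 x) (hs0 y)) (not_le.1 h))))
    have h6 : 1 / s x - 1 / s y = 0 := pow_eq_zero_iff two_ne_zero |>.1 (le_antisymm h5 (sq_nonneg _))
    have h7 := sub_eq_zero.1 h6
    rwa [one_div, one_div, inv_inj] at h7
  obtain ⟨w⟩ := G.connected.preconnected x y
  induction w with
  | nil => rfl
  | cons h _ ih => exact (hadj _ _ h).trans ih

/-- Maximum principle: a bounded function which is harmonic off a non-empty set `D` and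
nonpositive on `D` is nonpositive. -/
lemma IsCutoff.nonpos_of_harmonic {f : ℕ → V → ℝ} (hf : G.IsCutoff f) {u : V → ℝ} {K : ℝ}
    (hu : ∀ x, |u x| ≤ K) {D : Set V} (hD : D.Nonempty) (hu0 : ∀ x ∈ D, u x ≤ 0)
    (hharm : ∀ x ∉ D, G.laplacian u x = 0) (x : V) : u x ≤ 0 := by
  obtain ⟨d, hd⟩ := hD
  have hK : 0 ≤ K := (abs_nonneg _).trans (hu d)
  -- The positive part of `u` is subharmonic: it is minimal where `u ≤ 0`, and where `u > 0` the
  -- function `u` is harmonic and bounded above by its positive part. So `s` is superharmonic, and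
  -- the constant `K + 1` puts its values in `[1, K + 1]`.
  let s : V → ℝ := fun x => K + 1 - max (u x) 0
  have hb : ∀ x, 0 ≤ max (u x) 0 ∧ max (u x) 0 ≤ K := fun x =>
    ⟨le_max_right _ _, max_le ((le_abs_self _).trans (hu x)) hK⟩
  have hsabs : ∀ x, |s x| ≤ K + 1 := fun x => by
    rw [abs_le]
    constructor <;> simp only [s] <;> linarith [(hb x).1, (hb x).2]
  have hconst := hf.superharmonic_const (s := s) (K := K + 1)
    (fun x => by simp only [s]; linarith [(hb x).2])
    (fun x => by simp only [s]; linarith [(hb x).1]) ?_ x d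
  · have h1 : max (u x) 0 = max (u d) 0 := by simp only [s] at hconst; linarith
    rw [max_eq_right (hu0 d hd)] at h1
    exact max_eq_right_iff.1 h1
  · intro z
    have hsum : Summable fun y => G.cond z y * (s z - s y) :=
      (((G.summable_cond z).mul_right (s z)).sub (G.summable_cond_mul_row hsabs z)).congr
        fun y => by ring
    by_cases hz : u z ≤ 0
    · refine tsum_nonneg fun y => mul_nonneg (G.cond_nonneg _ _) ?_
      simp only [s]
      rw [max_eq_right hz]
      linarith [(hb y).1]
    · have hzD : z ∉ D := fun h => hz (hu0 z h)
      have h2 : G.laplacian (fun y => - u y) z = 0 := by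
        have := G.laplacian_const_mul (-1) u z
        rw [hharm z hzD, mul_zero] at this
        simpa using this
      rw [← h2]
      refine Summable.tsum_le_tsum (fun y => mul_le_mul_of_nonneg_left ?_ (G.cond_nonneg _ _))
        ?_ hsum
      · simp only [s]
        rw [max_eq_left (not_le.1 hz).le]
        linarith [le_max_left (u y) 0]
      · exact (((G.summable_cond z).mul_right (-u z)).add (G.summable_cond_mul_row hu z)).congr
          fun y => by ring

lemma IsCutoff.eq_zero_of_harmonic {f : ℕ → V → ℝ} (hf : G.IsCutoff f) {u : V → ℝ} {K : ℝ}
    (hu : ∀ x, |u x| ≤ K) {D : Set V} (hD : D.Nonempty) (hu0 : ∀ x ∈ D, u x = 0)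
    (hharm : ∀ x ∉ D, G.laplacian u x = 0) (x : V) : u x = 0 := by
  refine le_antisymm (hf.nonpos_of_harmonic hu hD (fun x hx => (hu0 x hx).le) hharm x) ?_
  have := hf.nonpos_of_harmonic (u := fun x => -u x) (K := K) (fun x => by rw [abs_neg]; exact hu x)
    hD (fun x hx => by rw [hu0 x hx, neg_zero]) (fun z hz => by
      have := G.laplacian_const_mul (-1) u z
      rw [hharm z hz, mul_zero] at this
      simpa using this) x
  linarith

end Energy

end ElectricalNetwork

namespace ElectricalNetwork

/-! ### Harmonic extensions and trace conductances -/

section HarmonicExtension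

variable {V : Type*} (G : ElectricalNetwork V)

/-- The energy of a function, up to a factor two, as an extended number. -/
noncomputable def energySum (u : V → ℝ) : ℝ≥0∞ :=
  ∑' p : V × V, ENNReal.ofReal (G.cond p.1 p.2 * (u p.1 - u p.2) ^ 2)

/-- A sum of non-negative continuous functions, for the topology of pointwise convergence in which
the minimizer is found by compactness. -/
lemma lowerSemicontinuous_energySum : LowerSemicontinuous G.energySum := by
  refine lowerSemicontinuous_tsum fun p => Continuous.lowerSemicontinuous ?_
  exact ENNReal.continuous_ofReal.comp (continuous_const.mul
    (((continuous_apply p.1).sub (continuous_apply p.2)).pow 2))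

variable {G}

lemma energySum_eq {u : V → ℝ} (hu : G.FiniteEnergy u) :
    G.energySum u = ENNReal.ofReal (2 * G.energy u u) := by
  rw [energySum, ← ENNReal.ofReal_tsum_of_nonneg (G.edge_nonneg u) hu, energy_self]
  congr 1
  ring

lemma finiteEnergy_of_energySum_ne_top {u : V → ℝ} (hu : G.energySum u ≠ ∞) :
    G.FiniteEnergy u :=
  (ENNReal.summable_toReal hu).congr fun p => ENNReal.toReal_ofReal (G.edge_nonneg u p)

lemma MemClosure.finiteEnergy {u : V → ℝ} (hu : G.MemClosure u) : G.FiniteEnergy u := hu.1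

variable {f : ℕ → V → ℝ} {B : Set V}

lemma abs_truncate_le_one (t : ℝ) : |truncate t| ≤ 1 := by
  rw [abs_of_nonneg (truncate_nonneg t)]
  exact truncate_le_one t

lemma indicator_mem (x b : B) : (0 : ℝ) ≤ Set.indicator {x} (fun _ => 1) b ∧
    Set.indicator {x} (fun _ => (1 : ℝ)) b ≤ 1 := by
  by_cases h : b = x <;> simp [h]

/-- Direct method: the functions with values in `[0, 1]` and the given boundary values form a
compact set, on which the lower semicontinuous energy has a minimum. It is finite because the point
mass at `x` competes. Truncation carries an arbitrary competitor into this set, and the cut-offs put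
the bounded minimizer in `𝓕⁽¹⁾`. -/
lemma IsCutoff.exists_isEnergyMinimizer (hf : G.IsCutoff f) (x : B) :
    ∃ u, G.IsEnergyMinimizer B (Set.indicator {x} fun _ => 1) u := by
  let K : Set (V → ℝ) := (Set.univ.pi fun _ => Set.Icc 0 1) ∩
    ⋂ b : B, {u | u b = Set.indicator {x} (fun _ => (1 : ℝ)) b}
  have hK : IsCompact K := (isCompact_univ_pi fun _ => isCompact_Icc).inter_right
    (isClosed_iInter fun b => isClosed_eq (continuous_apply _) continuous_const)
  have htrunc : ∀ w : V → ℝ, (∀ b : B, w b = Set.indicator {x} (fun _ => (1 : ℝ)) b) →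
      (fun y => truncate (w y)) ∈ K := fun w hw =>
    ⟨fun y _ => ⟨truncate_nonneg _, truncate_le_one _⟩, Set.mem_iInter.2 fun b => by
      rw [Set.mem_ofPred_eq]
      simp only [hw b, truncate_of_mem (indicator_mem x b).1 (indicator_mem x b).2]⟩
  have hδ : ∀ b : B, Set.indicator {(x : V)} (fun _ => (1 : ℝ)) b =
      Set.indicator {x} (fun _ => (1 : ℝ)) b := fun b => by
    by_cases h : b = x
    · simp [h]
    · simp [h, Subtype.val_injective.ne h]
  obtain ⟨u, huK, hmin⟩ := LowerSemicontinuousOn.exists_isMinOn (f := G.energySum)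
    ⟨_, htrunc _ hδ⟩ hK (G.lowerSemicontinuous_energySum.lowerSemicontinuousOn _)
  have hle : ∀ w : V → ℝ, (∀ b : B, w b = Set.indicator {x} (fun _ => (1 : ℝ)) b) →
      G.FiniteEnergy w → G.energySum u ≤ ENNReal.ofReal (2 * G.energy w w) := by
    intro w hw hwE
    have hc : ∀ y z, |truncate (w y) - truncate (w z)| ≤ |w y - w z| :=
      fun _ _ => abs_truncate_sub_le _ _
    refine (hmin (htrunc w hw)).trans ?_
    rw [energySum_eq (hwE.of_contraction hc)]
    exact ENNReal.ofReal_le_ofReal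
      (mul_le_mul_of_nonneg_left (hwE.energy_le_of_contraction hc) zero_le_two)
  have huE : G.FiniteEnergy u := by
    refine finiteEnergy_of_energySum_ne_top ((hle _ hδ
      (G.finiteEnergy_of_finite_support ?_)).trans_lt ENNReal.ofReal_lt_top).ne
    exact (Set.finite_singleton (x : V)).subset Set.support_indicator_subset
  have hub : ∀ y, |u y| ≤ 1 := fun y => by
    have := huK.1 y (Set.mem_univ _)
    rw [abs_of_nonneg this.1]
    exact this.2
  refine ⟨u, ⟨hf.memClosure hub huE, fun b => Set.mem_iInter.1 huK.2 b⟩, fun w hw => ?_⟩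
  have := hle w hw.2 hw.1.finiteEnergy
  rw [energySum_eq huE, ENNReal.ofReal_le_ofReal_iff (by
    have := G.energy_self_nonneg w; positivity)] at this
  linarith

/-- The truncation of `u` competes, so by minimality truncating shortens the increment of `u` on no
edge. An edge leaving `[0, 1]` would be shortened; hence the bound spreads from `x` along walks. It
is proved for every minimizer because `harmonicExtension` chooses an arbitrary one. -/
lemma IsCutoff.mem_Icc_of_isEnergyMinimizer (hf : G.IsCutoff f) {x : B} {u : V → ℝ}
    (hu : G.IsEnergyMinimizer B (Set.indicator {x} fun _ => 1) u) (y : V) :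
    u y ∈ Set.Icc (0 : ℝ) 1 := by
  have hc : ∀ y z, |truncate (u y) - truncate (u z)| ≤ |u y - u z| :=
    fun _ _ => abs_truncate_sub_le _ _
  have huE := hu.1.1.finiteEnergy
  have htE := huE.of_contraction hc
  have hle := hu.2 (fun y => truncate (u y)) ⟨hf.memClosure (fun _ => abs_truncate_le_one _) htE,
    fun b => by
      rw [hu.1.2 b, truncate_of_mem (indicator_mem x b).1 (indicator_mem x b).2]⟩
  have hedge : ∀ y z, G.graph.Adj y z → |truncate (u y) - truncate (u z)| = |u y - u z| := by
    intro y z hyz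
    have hpos := (G.cond_pos_iff y z).2 hyz
    refine le_antisymm (hc y z) (le_of_not_gt fun hlt => ?_)
    have := Summable.tsum_lt_tsum (i := (y, z))
      (fun p => mul_le_mul_of_nonneg_left (sq_le_sq.2 (hc p.1 p.2)) (G.cond_nonneg p.1 p.2))
      (mul_lt_mul_of_pos_left (sq_lt_sq.2 hlt) hpos) htE huE
    rw [energy_self, energy_self] at hle
    linarith
  have hstep : ∀ y z, G.graph.Adj y z → u y ∈ Set.Icc (0 : ℝ) 1 → u z ∈ Set.Icc (0 : ℝ) 1 := by
    rintro y z hyz ⟨h0, h1⟩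
    have h := hedge y z hyz
    rw [truncate_of_mem h0 h1] at h
    constructor
    · by_contra! hz
      rw [show truncate (u z) = 0 by rw [truncate, min_eq_left (by linarith), max_eq_right hz.le],
        abs_of_nonneg (by linarith), abs_of_nonneg (by linarith)] at h
      linarith
    · by_contra! hz
      rw [show truncate (u z) = 1 by
          rw [truncate, min_eq_right hz.le, max_eq_left zero_le_one],
        abs_of_nonpos (by linarith), abs_of_nonpos (by linarith)] at h
      linarith
  have hx : u x ∈ Set.Icc (0 : ℝ) 1 := by
    rw [hu.1.2 x]
    exact indicator_mem x x
  obtain ⟨w⟩ := G.connected.preconnected x y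
  have hw : ∀ {a b : V} (_ : G.graph.Walk a b), u a ∈ Set.Icc (0 : ℝ) 1 →
      u b ∈ Set.Icc (0 : ℝ) 1 := by
    intro a b w
    induction w with
    | nil => exact id
    | cons h _ ih => exact fun ha => ih (hstep _ _ h ha)
  exact hw w hx

variable (G) in
/-- The harmonic extension of the indicator function of a point of `B`; its value at `z` is the
probability that the chain started at `z` enters `B` at `x`. -/
noncomputable def harmonicMeasure (B : Set V) (x : B) : V → ℝ :=
  G.harmonicExtension B (Set.indicator {x} fun _ => 1)

lemma IsCutoff.isEnergyMinimizer_harmonicMeasure (hf : G.IsCutoff f) (x : B) :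
    G.IsEnergyMinimizer B (Set.indicator {x} fun _ => 1) (G.harmonicMeasure B x) := by
  rw [harmonicMeasure, harmonicExtension, dif_pos (hf.exists_isEnergyMinimizer x)]
  exact (hf.exists_isEnergyMinimizer x).choose_spec

lemma IsCutoff.harmonicMeasure_nonneg (hf : G.IsCutoff f) (x : B) (y : V) :
    0 ≤ G.harmonicMeasure B x y :=
  (hf.mem_Icc_of_isEnergyMinimizer (hf.isEnergyMinimizer_harmonicMeasure x) y).1

lemma IsCutoff.harmonicMeasure_le_one (hf : G.IsCutoff f) (x : B) (y : V) :
    G.harmonicMeasure B x y ≤ 1 :=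
  (hf.mem_Icc_of_isEnergyMinimizer (hf.isEnergyMinimizer_harmonicMeasure x) y).2

lemma IsCutoff.abs_harmonicMeasure_le_one (hf : G.IsCutoff f) (x : B) (y : V) :
    |G.harmonicMeasure B x y| ≤ 1 := by
  rw [abs_of_nonneg (hf.harmonicMeasure_nonneg x y)]
  exact hf.harmonicMeasure_le_one x y

lemma IsCutoff.finiteEnergy_harmonicMeasure (hf : G.IsCutoff f) (x : B) :
    G.FiniteEnergy (G.harmonicMeasure B x) :=
  (hf.isEnergyMinimizer_harmonicMeasure x).1.1.finiteEnergy

lemma IsCutoff.harmonicMeasure_self (hf : G.IsCutoff f) (x : B) :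
    G.harmonicMeasure B x x = 1 := by
  simpa using (hf.isEnergyMinimizer_harmonicMeasure x).1.2 x

lemma IsCutoff.harmonicMeasure_of_ne (hf : G.IsCutoff f) {x y : B} (h : y ≠ x) :
    G.harmonicMeasure B x y = 0 := by
  simpa [h] using (hf.isEnergyMinimizer_harmonicMeasure x).1.2 y

/-- The harmonic extension is orthogonal to the bounded functions vanishing on `B`. -/
lemma IsCutoff.energy_harmonicMeasure_eq_zero (hf : G.IsCutoff f) (x : B) {w : V → ℝ} {K : ℝ}
    (hw : ∀ y, |w y| ≤ K) (hwE : G.FiniteEnergy w) (hwB : ∀ b ∈ B, w b = 0) :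
    G.energy (G.harmonicMeasure B x) w = 0 := by
  set h := G.harmonicMeasure B x with hh
  have hhE := hf.finiteEnergy_harmonicMeasure x
  -- First variation: `h + t w` has the boundary values of `h` for every `t`.
  have hmin : ∀ t : ℝ, 0 ≤ 2 * t * G.energy h w + t ^ 2 * G.energy w w := by
    intro t
    have h1 := (hf.isEnergyMinimizer_harmonicMeasure x).2 (fun y => h y + t * w y)
      ⟨hf.memClosure (K := 1 + |t| * K) (fun y => ?_) (hhE.add_smul hwE t), fun b => ?_⟩
    · rw [hhE.energy_add_smul hwE t] at h1
      linarith
    · refine (abs_add_le _ _).trans (add_le_add (hf.abs_harmonicMeasure_le_one x y) ?_)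
      rw [abs_mul]
      exact mul_le_mul_of_nonneg_left (hw y) (abs_nonneg t)
    · rw [hwB b b.2, mul_zero, add_zero]
      exact (hf.isEnergyMinimizer_harmonicMeasure x).1.2 b
  have hW := G.energy_self_nonneg w
  by_contra hne
  rcases hW.eq_or_lt with h0 | h0
  · have := hmin (-G.energy h w)
    rw [← h0] at this
    nlinarith [sq_pos_of_ne_zero hne]
  · have := hmin (-G.energy h w / G.energy w w)
    have h2 : 2 * (-G.energy h w / G.energy w w) * G.energy h w +
        (-G.energy h w / G.energy w w) ^ 2 * G.energy w w =
        - (G.energy h w ^ 2 / G.energy w w) := by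
      field_simp
      ring
    rw [h2] at this
    have h3 : 0 < G.energy h w ^ 2 / G.energy w w := div_pos (sq_pos_of_ne_zero hne) h0
    linarith

lemma finite_support_indicator_singleton (z : V) :
    (Function.support (Set.indicator {z} fun _ => (1 : ℝ))).Finite :=
  (Set.finite_singleton z).subset Set.support_indicator_subset

lemma energy_indicator {u : V → ℝ} {K : ℝ} (hu : ∀ x, |u x| ≤ K) (z : V) :
    G.energy u (Set.indicator {z} fun _ => 1) = G.laplacian u z := by
  rw [G.energy_of_finite_support hu (finite_support_indicator_singleton z),
    tsum_eq_single z fun y hy => by simp [hy]]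
  simp

lemma abs_indicator_singleton_le (z y : V) : |Set.indicator {z} (fun _ => (1 : ℝ)) y| ≤ 1 := by
  by_cases h : y = z <;> simp [h]

/-- Test the orthogonality against the point mass at `z`, which vanishes on `B`. -/
lemma IsCutoff.laplacian_harmonicMeasure (hf : G.IsCutoff f) (x : B) {z : V} (hz : z ∉ B) :
    G.laplacian (G.harmonicMeasure B x) z = 0 := by
  rw [← energy_indicator (hf.abs_harmonicMeasure_le_one x)]
  refine hf.energy_harmonicMeasure_eq_zero x (abs_indicator_singleton_le z)
    (G.finiteEnergy_of_finite_support (finite_support_indicator_singleton z)) fun b hb => ?_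
  rw [Set.indicator_of_notMem]
  rintro rfl
  exact hz hb

/-- The second extension may be replaced by the point mass at `y`, since their difference vanishes
on `B`. -/
lemma IsCutoff.energy_harmonicMeasure (hf : G.IsCutoff f) (x y : B) :
    G.energy (G.harmonicMeasure B x) (G.harmonicMeasure B y) =
      G.laplacian (G.harmonicMeasure B x) y := by
  have hδ := G.finiteEnergy_of_finite_support (finite_support_indicator_singleton (y : V))
  have hy := hf.finiteEnergy_harmonicMeasure y
  have h := hf.energy_harmonicMeasure_eq_zero x
    (w := fun z => G.harmonicMeasure B y z - Set.indicator {(y : V)} (fun _ => 1) z) (K := 1 + 1)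
    (fun z => (abs_sub _ _).trans (add_le_add (hf.abs_harmonicMeasure_le_one y z)
      (abs_indicator_singleton_le _ _))) (hy.sub hδ) fun b hb => by
      by_cases h : b = y
      · subst h
        simp [hf.harmonicMeasure_self y]
      · rw [hf.harmonicMeasure_of_ne (x := y) (y := ⟨b, hb⟩) (fun h' => h (Subtype.ext_iff.1 h'))]
        simp [h]
  rw [(hf.finiteEnergy_harmonicMeasure x).energy_sub_right hy hδ, sub_eq_zero] at h
  rw [h, energy_indicator (hf.abs_harmonicMeasure_le_one x)]

lemma traceCond_self (x : B) : G.traceCond B x x = 0 := by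
  rw [traceCond, if_pos rfl]

lemma traceCond_of_ne {x y : B} (h : x ≠ y) : G.traceCond B x y =
    -G.energy (G.harmonicMeasure B x) (G.harmonicMeasure B y) := by
  rw [traceCond, if_neg h]
  rfl

lemma traceCond_comm (x y : B) : G.traceCond B x y = G.traceCond B y x := by
  rcases eq_or_ne x y with rfl | h
  · rfl
  · rw [traceCond_of_ne h, traceCond_of_ne h.symm, energy_comm]

/-- This is minus the Laplacian at `y`, where the extension itself is `0`. The form makes
non-negativity and positivity of the trace conductances visible. -/
lemma IsCutoff.traceCond_eq_tsum (hf : G.IsCutoff f) {x y : B} (h : x ≠ y) :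
    G.traceCond B x y = ∑' z, G.cond y z * G.harmonicMeasure B x z := by
  rw [traceCond_of_ne h, hf.energy_harmonicMeasure,
    G.laplacian_eq (hf.abs_harmonicMeasure_le_one x), hf.harmonicMeasure_of_ne h.symm]
  ring

lemma IsCutoff.traceCond_nonneg (hf : G.IsCutoff f) (x y : B) : 0 ≤ G.traceCond B x y := by
  rcases eq_or_ne x y with rfl | h
  · rw [traceCond_self]
  · rw [hf.traceCond_eq_tsum h]
    exact tsum_nonneg fun z => mul_nonneg (G.cond_nonneg _ _) (hf.harmonicMeasure_nonneg x z)

lemma IsCutoff.traceCond_pos (hf : G.IsCutoff f) {x y : B} (h : x ≠ y) {z : V}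
    (hyz : G.graph.Adj y z) (hz : 0 < G.harmonicMeasure B x z) : 0 < G.traceCond B x y := by
  rw [hf.traceCond_eq_tsum h]
  exact (G.summable_cond_mul_row (hf.abs_harmonicMeasure_le_one x) y).tsum_pos
    (fun z => mul_nonneg (G.cond_nonneg _ _) (hf.harmonicMeasure_nonneg x z)) z
    (mul_pos ((G.cond_pos_iff _ _).2 hyz) hz)

lemma IsCutoff.harmonicMeasure_pos_of_adj (hf : G.IsCutoff f) {x : B} {y z : V} (hy : y ∉ B)
    (hyz : G.graph.Adj y z) (hz : 0 < G.harmonicMeasure B x z) :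
    0 < G.harmonicMeasure B x y := by
  have h := hf.laplacian_harmonicMeasure x hy
  rw [G.laplacian_eq (hf.abs_harmonicMeasure_le_one x), sub_eq_zero] at h
  have h1 : 0 < G.totalCond y * G.harmonicMeasure B x y := by
    rw [h]
    exact (G.summable_cond_mul_row (hf.abs_harmonicMeasure_le_one x) y).tsum_pos
      (fun z => mul_nonneg (G.cond_nonneg _ _) (hf.harmonicMeasure_nonneg x z)) z
      (mul_pos ((G.cond_pos_iff _ _).2 hyz) hz)
  exact pos_of_mul_pos_right h1 (tsum_nonneg (G.cond_nonneg y))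

variable (G B) in
/-- The graph of the trace network. -/
def traceGraph : SimpleGraph B where
  Adj x y := 0 < G.traceCond B x y
  symm := ⟨fun x y h => by rwa [traceCond_comm]⟩
  loopless := ⟨fun x h => by rw [traceCond_self] at h; exact lt_irrefl _ h⟩

/-- Follow the walk backwards from `x`, keeping a point `b` in the component of `x` whose harmonic
measure charges the current vertex. Off `B` harmonicity transmits positivity to the next vertex; a
vertex of `B` equals `b` or is joined to it by a trace edge, and becomes the new `b`. -/
lemma IsCutoff.exists_reachable (hf : G.IsCutoff f) {z : V} {x : B} (w : G.graph.Walk z x) :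
    ∃ b : B, (G.traceGraph B).Reachable b x ∧ 0 < G.harmonicMeasure B b z := by
  generalize hv : (x : V) = v at w
  induction w with
  | nil =>
    subst hv
    exact ⟨x, SimpleGraph.Reachable.refl _, by rw [hf.harmonicMeasure_self]; exact one_pos⟩
  | @cons a c d h _ ih =>
    obtain ⟨b, hb, hpos⟩ := ih hv
    by_cases ha : a ∈ B
    · refine ⟨⟨a, ha⟩, ?_, by rw [hf.harmonicMeasure_self ⟨a, ha⟩]; exact one_pos⟩
      rcases eq_or_ne b ⟨a, ha⟩ with rfl | hne
      · exact hb
      · have hadj : (G.traceGraph B).Adj b ⟨a, ha⟩ := hf.traceCond_pos hne h hpos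
        exact hadj.symm.reachable.trans hb
    · exact ⟨b, hb, hf.harmonicMeasure_pos_of_adj ha h hpos⟩

lemma IsCutoff.connected_traceGraph (hf : G.IsCutoff f) (hB : B.Nonempty) :
    (G.traceGraph B).Connected := by
  have := hB.to_subtype
  refine ⟨fun y x => ?_⟩
  obtain ⟨w⟩ := G.connected.preconnected y x
  obtain ⟨b, hb, hpos⟩ := hf.exists_reachable w
  rcases eq_or_ne y b with rfl | hne
  · exact hb
  · rw [hf.harmonicMeasure_of_ne hne] at hpos
    exact absurd hpos (lt_irrefl _)

/-- Zero energy would make the extension constant on the connected graph, but it is `1` at `x` and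
`0` at `y`. -/
lemma IsCutoff.energy_harmonicMeasure_pos (hf : G.IsCutoff f) {x y : B} (hxy : x ≠ y) :
    0 < G.energy (G.harmonicMeasure B x) (G.harmonicMeasure B x) := by
  by_contra! h0
  have hadj : ∀ a b, G.graph.Adj a b → G.harmonicMeasure B x a = G.harmonicMeasure B x b := by
    intro a b hab
    have h1 := G.edge_le_energy (hf.finiteEnergy_harmonicMeasure x) a b
    have h2 := (G.cond_pos_iff a b).2 hab
    by_contra hne
    have := mul_pos h2 (sq_pos_of_ne_zero (sub_ne_zero.2 hne))
    linarith
  obtain ⟨w⟩ := G.connected.preconnected x y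
  have hw : ∀ {a b : V} (_ : G.graph.Walk a b),
      G.harmonicMeasure B x a = G.harmonicMeasure B x b := by
    intro a b w
    induction w with
    | nil => rfl
    | cons h _ ih => exact (hadj _ _ h).trans ih
  have := hw w
  rw [hf.harmonicMeasure_self, hf.harmonicMeasure_of_ne hxy.symm] at this
  exact one_ne_zero this

/-- The exit distribution: a bounded function which is harmonic off `B \ {y}` and equal to the
indicator function of `{x}` on `B \ {y}` has at `y` the value given by the trace conductances. -/
lemma IsCutoff.traceCond_eq_mul (hf : G.IsCutoff f) {x y : B} (hxy : x ≠ y) {g : V → ℝ} {K : ℝ}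
    (hg : ∀ z, |g z| ≤ K) (hgx : g x = 1) (hg0 : ∀ b : B, b ≠ y → b ≠ x → g b = 0)
    (hharm : ∀ z ∉ B \ {(y : V)}, G.laplacian g z = 0) :
    G.traceCond B y x = g y * G.energy (G.harmonicMeasure B y) (G.harmonicMeasure B y) := by
  have hx := hf.abs_harmonicMeasure_le_one x
  have hy := hf.abs_harmonicMeasure_le_one y
  have hgy : ∀ z, |g y * G.harmonicMeasure B y z| ≤ K * 1 := fun z => by
    rw [abs_mul]
    exact mul_le_mul (hg _) (hy z) (abs_nonneg _) ((abs_nonneg _).trans (hg y))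
  have hgx' : ∀ z, |g z - G.harmonicMeasure B x z| ≤ K + 1 := fun z =>
    (abs_sub _ _).trans (add_le_add (hg z) (hx z))
  have hsub : ∀ z, G.laplacian
      (fun z => g z - G.harmonicMeasure B x z - g y * G.harmonicMeasure B y z) z =
      G.laplacian g z - G.laplacian (G.harmonicMeasure B x) z -
        g y * G.laplacian (G.harmonicMeasure B y) z := fun z => by
    rw [G.laplacian_sub hgx' hgy, G.laplacian_sub hg hx, G.laplacian_const_mul]
  -- Uniqueness gives `g = h_x + g(y) h_y`. Since `g` is harmonic at `y` too, the Laplacian of this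
  -- identity at `y` relates the two energies.
  have heq := hf.eq_zero_of_harmonic (D := B)
    (u := fun z => g z - G.harmonicMeasure B x z - g y * G.harmonicMeasure B y z)
    (fun z => (abs_sub _ _).trans (add_le_add (hgx' z) (hgy z))) ⟨x, x.2⟩ ?_ ?_
  · have h0 := hsub y
    rw [hharm y fun h => h.2 rfl, funext heq] at h0
    simp only [laplacian, sub_self, mul_zero, tsum_zero] at h0
    rw [traceCond_comm, traceCond_of_ne hxy, hf.energy_harmonicMeasure,
      hf.energy_harmonicMeasure, laplacian, laplacian]
    linarith
  · intro b hb
    rcases eq_or_ne (⟨b, hb⟩ : B) x with h | h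
    · obtain rfl : b = x := congrArg Subtype.val h
      rw [hgx, hf.harmonicMeasure_self, hf.harmonicMeasure_of_ne hxy]
      ring
    · have hb' := hf.harmonicMeasure_of_ne h
      simp only at hb'
      rw [hb']
      rcases eq_or_ne (⟨b, hb⟩ : B) y with h' | h'
      · obtain rfl : b = y := congrArg Subtype.val h'
        rw [hf.harmonicMeasure_self]
        ring
      · have hb2 := hf.harmonicMeasure_of_ne h'
        have hb3 := hg0 _ h' h
        simp only at hb2 hb3
        rw [hb2, hb3]
        ring
  · intro z hz
    rw [hsub, hharm z fun h => hz h.1, hf.laplacian_harmonicMeasure x hz,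
      hf.laplacian_harmonicMeasure y hz]
    ring

end HarmonicExtension

end ElectricalNetwork

/-! ### Laws of sequences, cylinders and the Markov property -/

/-- Two probability measures on the space of sequences in a countable space are equal if they are
comparable on the cylinder sets. -/
lemma MeasureTheory.Measure.ext_of_le_cylinder {E : Type*} [Countable E] [MeasurableSpace E]
    [DiscreteMeasurableSpace E] {μ ν : Measure (ℕ → E)} [IsProbabilityMeasure μ]
    [IsProbabilityMeasure ν]
    (h : ∀ (n : ℕ) (a : ℕ → E), μ {p | ∀ i ≤ n, p i = a i} ≤ ν {p | ∀ i ≤ n, p i = a i}) :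
    μ = ν := by
  have hne : Nonempty E := by
    by_contra hE
    rw [not_nonempty_iff] at hE
    have := measure_univ (μ := μ)
    rw [Set.eq_empty_of_isEmpty (Set.univ : Set (ℕ → E)), measure_empty] at this
    exact zero_ne_one this
  have hmarg : ∀ n : ℕ, μ.map (Preorder.frestrictLe n) = ν.map (Preorder.frestrictLe n) := by
    intro n
    have hm : Measurable (Preorder.frestrictLe (π := fun _ : ℕ => E) n) :=
      Preorder.measurable_frestrictLe n
    have := Measure.isProbabilityMeasure_map (μ := μ) hm.aemeasurable
    have := Measure.isProbabilityMeasure_map (μ := ν) hm.aemeasurable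
    -- Equal total mass turns the inequality into equality. On the countable space of initial
    -- segments it need only be checked on singletons, that is, on cylinders.
    refine Measure.eq_of_le_of_isProbabilityMeasure (Measure.le_iff.2 fun s _ => ?_)
    rw [← Measure.tsum_indicator_apply_singleton _ s (Set.to_countable s).measurableSet,
      ← Measure.tsum_indicator_apply_singleton _ s (Set.to_countable s).measurableSet]
    refine ENNReal.tsum_le_tsum fun x => Set.indicator_le_indicator ?_
    rw [Measure.map_apply hm (measurableSet_singleton x),
      Measure.map_apply hm (measurableSet_singleton x)]
    let a : ℕ → E := fun i => if hi : i ≤ n then x ⟨i, Finset.mem_Iic.2 hi⟩ else hne.some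
    have hpre : Preorder.frestrictLe (π := fun _ : ℕ => E) n ⁻¹' {x} = {p : ℕ → E | ∀ i ≤ n, p i = a i} := by
      ext p
      simp only [Set.mem_preimage, Set.mem_singleton_iff, Set.mem_ofPred_eq, funext_iff]
      constructor
      · intro hp i hi
        rw [show a i = x ⟨i, Finset.mem_Iic.2 hi⟩ from dif_pos hi]
        exact hp ⟨i, Finset.mem_Iic.2 hi⟩
      · rintro hp ⟨i, hi⟩
        have hi' := Finset.mem_Iic.1 hi
        exact (hp i hi').trans (dif_pos hi')
    rw [hpre]
    exact h n a
  have hfin : ∀ I : Finset ℕ, IsFiniteMeasure (ν.map I.restrict) := fun I => inferInstance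
  refine IsProjectiveLimit.unique (P := fun I : Finset ℕ => ν.map I.restrict) (fun I => ?_)
    fun I => rfl
  have hI : I ⊆ Finset.Iic (I.sup id) := I.subset_Iic_sup_id
  have hcomp : (I.restrict : (ℕ → E) → _) =
      Finset.restrict₂ (π := fun _ => E) hI ∘ Preorder.frestrictLe (I.sup id) := rfl
  simp only
  rw [hcomp, ← Measure.map_map (by fun_prop) (by fun_prop),
    ← Measure.map_map (by fun_prop) (by fun_prop), hmarg]

namespace ElectricalNetwork

section Chain

variable {V : Type*} [Countable V] [MeasurableSpace V] [DiscreteMeasurableSpace V]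
  (G : ElectricalNetwork V)

instance (ρ : V) : IsProbabilityMeasure (G.chainLaw ρ) :=
  inferInstanceAs (IsProbabilityMeasure (Kernel.traj (X := fun _ => V) G.nextKernel 0 fun _ => ρ))

lemma measurableSet_cylinder (n : ℕ) (a : ℕ → V) :
    MeasurableSet {p : ℕ → V | ∀ i ≤ n, p i = a i} := by
  simp only [Set.ofPred_forall]
  exact MeasurableSet.iInter fun i => MeasurableSet.iInter fun _ =>
    measurableSet_eq_fun (measurable_pi_apply i) measurable_const

/-- The joint law of the initial segment and the next position is the composition product of the law
of the segment with `nextKernel`; evaluate it on a product of two singletons. -/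
lemma chainLaw_cylinder_succ (ρ : V) (n : ℕ) (a : ℕ → V) :
    G.chainLaw ρ {p | ∀ i ≤ n + 1, p i = a i} =
      G.chainLaw ρ {p | ∀ i ≤ n, p i = a i} * G.stepPMF (a n) (a (n + 1)) := by
  have hm : Measurable (Preorder.frestrictLe (π := fun _ : ℕ => V) n) :=
    Preorder.measurable_frestrictLe n
  have h := congrArg (fun μ => μ ({Preorder.frestrictLe (π := fun _ : ℕ => V) n a} ×ˢ {a (n + 1)}))
    (Kernel.partialTraj_compProd_eq_map_traj (X := fun _ => V) (κ := G.nextKernel)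
      (zero_le : 0 ≤ n) (x₀ := fun _ => ρ))
  have hcyl : Preorder.frestrictLe (π := fun _ : ℕ => V) n ⁻¹' {Preorder.frestrictLe n a} =
      {p : ℕ → V | ∀ i ≤ n, p i = a i} := by
    ext p
    simp only [Set.mem_preimage, Set.mem_singleton_iff, Set.mem_ofPred_eq, funext_iff]
    exact ⟨fun hp i hi => hp ⟨i, Finset.mem_Iic.2 hi⟩,
      fun hp i => hp i (Finset.mem_Iic.1 i.2)⟩
  rw [Measure.compProd_apply_prod (measurableSet_singleton _) (measurableSet_singleton _),
    lintegral_singleton, ← Kernel.traj_map_frestrictLe_apply,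
    Measure.map_apply hm (measurableSet_singleton _),
    Measure.map_apply (by fun_prop) ((measurableSet_singleton _).prod (measurableSet_singleton _)),
    hcyl] at h
  have hstep : G.nextKernel n (Preorder.frestrictLe n a) {a (n + 1)} =
      G.stepPMF (a n) (a (n + 1)) :=
    PMF.toMeasure_apply_singleton _ _ (measurableSet_singleton _)
  rw [hstep] at h
  rw [chainLaw, mul_comm, h]
  congr 1
  ext p
  simp only [Set.mem_preimage, Set.mem_prod, Set.mem_singleton_iff, Set.mem_ofPred_eq]
  have hp := Set.ext_iff.1 hcyl p
  simp only [Set.mem_preimage, Set.mem_singleton_iff, Set.mem_ofPred_eq] at hp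
  rw [hp]
  constructor
  · exact fun h => ⟨fun i hi => h i (Nat.le_succ_of_le hi), h _ le_rfl⟩
  · rintro ⟨h1, h2⟩ i hi
    rcases Nat.le_succ_iff.1 hi with hi | rfl
    · exact h1 i hi
    · exact h2

lemma ae_chainLaw_zero (ρ : V) : ∀ᵐ p ∂G.chainLaw ρ, p 0 = ρ := by
  have h := Kernel.traj_map_frestrictLe_apply (X := fun _ => V) (κ := G.nextKernel) 0 0
    (fun _ => ρ)
  rw [Kernel.partialTraj_self, Kernel.id_apply] at h
  have h2 : ∀ᵐ h ∂(G.chainLaw ρ).map (Preorder.frestrictLe 0),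
      h = fun _ : Finset.Iic 0 => ρ := by
    rw [chainLaw, h]
    exact (ae_dirac_iff (measurableSet_singleton _)).2 rfl
  have h3 := ae_of_ae_map (Preorder.measurable_frestrictLe 0).aemeasurable h2
  filter_upwards [h3] with p hp
  exact congrFun hp ⟨0, Finset.mem_Iic.2 le_rfl⟩

open Classical in
lemma chainLaw_cylinder (ρ : V) (n : ℕ) (a : ℕ → V) :
    G.chainLaw ρ {p | ∀ i ≤ n, p i = a i} =
      (if ρ = a 0 then 1 else 0) * ∏ i ∈ Finset.range n, G.stepPMF (a i) (a (i + 1)) := by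
  induction n with
  | zero =>
    have hae := G.ae_chainLaw_zero ρ
    simp only [Nat.le_zero, forall_eq, Finset.range_zero, Finset.prod_empty, mul_one]
    split_ifs with h
    · rw [← h]
      exact mem_ae_iff_prob_eq_one
        (measurableSet_eq_fun (measurable_pi_apply 0) measurable_const) |>.1 hae
    · rw [measure_eq_zero_iff_ae_notMem]
      filter_upwards [hae] with p hp hp'
      exact h (hp.symm.trans hp')
  | succ n ih => rw [chainLaw_cylinder_succ, ih, Finset.prod_range_succ, mul_assoc]

/-- The Markov property at the first step. -/
lemma chainLaw_map_shift (ρ : V) : (G.chainLaw ρ).map (fun p n => p (n + 1)) =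
    Measure.sum fun z => G.stepPMF ρ z • G.chainLaw z := by
  classical
  have hm : Measurable fun (p : ℕ → V) (n : ℕ) => p (n + 1) :=
    measurable_pi_lambda _ fun n => measurable_pi_apply (n + 1)
  have := Measure.isProbabilityMeasure_map (μ := G.chainLaw ρ) hm.aemeasurable
  have : IsProbabilityMeasure (Measure.sum fun z => G.stepPMF ρ z • G.chainLaw z) := by
    refine ⟨?_⟩
    rw [Measure.sum_apply _ MeasurableSet.univ]
    simp only [Measure.smul_apply, measure_univ, smul_eq_mul, mul_one]
    exact (G.stepPMF ρ).tsum_coe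
  refine Measure.ext_of_le_cylinder fun n a => le_of_eq ?_
  rw [Measure.map_apply hm (measurableSet_cylinder n a),
    Measure.sum_apply _ (measurableSet_cylinder n a)]
  -- Prepending `ρ` to `a` turns the shifted cylinder into a cylinder, up to a null set.
  obtain ⟨c, hc0, hc⟩ : ∃ c : ℕ → V, c 0 = ρ ∧ ∀ i, c (i + 1) = a i :=
    ⟨fun i => Nat.casesOn i ρ a, rfl, fun _ => rfl⟩
  have h1 : G.chainLaw ρ ((fun p n => p (n + 1)) ⁻¹' {p | ∀ i ≤ n, p i = a i}) =
      G.chainLaw ρ {p | ∀ i ≤ n + 1, p i = c i} := by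
    refine measure_congr ?_
    filter_upwards [G.ae_chainLaw_zero ρ] with p hp
    refine propext ⟨fun h i hi => ?_, fun h i hi =>
      (h (i + 1) (Nat.succ_le_succ hi)).trans (hc i)⟩
    cases i with
    | zero => exact hp.trans hc0.symm
    | succ i => exact (h i (Nat.le_of_succ_le_succ hi)).trans (hc i).symm
  rw [h1, chainLaw_cylinder, if_pos hc0.symm, one_mul, Finset.prod_range_succ']
  simp only [Measure.smul_apply, smul_eq_mul, chainLaw_cylinder, hc, hc0]
  rw [tsum_eq_single (a 0) fun z hz => by rw [if_neg hz, zero_mul, mul_zero], if_pos rfl, one_mul]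
  exact mul_comm _ _

/-- The probability of a set of paths, as a function of the starting point. -/
noncomputable def pathProb (S : Set (ℕ → V)) (z : V) : ℝ := (G.chainLaw z).real S

lemma abs_pathProb_le_one (S : Set (ℕ → V)) (z : V) : |G.pathProb S z| ≤ 1 := by
  rw [pathProb, abs_of_nonneg measureReal_nonneg]
  exact measureReal_le_one

/-- The probability of a set of paths is harmonic at the points at which the first step is
irrelevant. -/
lemma laplacian_pathProb {S : Set (ℕ → V)} (hS : MeasurableSet S) {z : V}
    (h : ∀ p : ℕ → V, p 0 = z → (p ∈ S ↔ (fun n => p (n + 1)) ∈ S)) :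
    G.laplacian (G.pathProb S) z = 0 := by
  have hm : Measurable fun (p : ℕ → V) (n : ℕ) => p (n + 1) :=
    measurable_pi_lambda _ fun n => measurable_pi_apply (n + 1)
  have h1 : G.chainLaw z S = ∑' w, G.stepPMF z w * G.chainLaw w S := by
    have h2 : G.chainLaw z S = (G.chainLaw z).map (fun p n => p (n + 1)) S := by
      rw [Measure.map_apply hm hS]
      refine measure_congr ?_
      filter_upwards [G.ae_chainLaw_zero z] with p hp
      exact propext (h p hp)
    rw [h2, chainLaw_map_shift, Measure.sum_apply _ hS]
    rfl
  have h3 : G.pathProb S z = ∑' w, G.transProb z w * G.pathProb S w := by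
    rw [pathProb, Measure.real, h1, ENNReal.tsum_toReal_eq]
    · refine tsum_congr fun w => ?_
      rw [ENNReal.toReal_mul, show G.stepPMF z w = ENNReal.ofReal (G.transProb z w) from rfl,
        ENNReal.toReal_ofReal (G.transProb_nonneg z w)]
      rfl
    · exact fun w => ENNReal.mul_ne_top ENNReal.ofReal_ne_top (measure_ne_top _ _)
  -- If `c(z) = 0`, all conductances at `z` vanish and so does the Laplacian. Otherwise the one-step
  -- average is multiplied by `c(z)`.
  by_cases h0 : G.totalCond z = 0
  · have hc := (hasSum_zero_iff_of_nonneg (G.cond_nonneg z)).1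
      ((G.summable_cond z).hasSum_iff.2 h0)
    simp [laplacian, hc]
  · rw [G.laplacian_eq (G.abs_pathProb_le_one S), h3, ← tsum_mul_left, sub_eq_zero]
    refine tsum_congr fun w => ?_
    rw [transProb, if_neg h0]
    field_simp

end Chain

end ElectricalNetwork

/-! ### Order of visits along a fixed path -/

section TracePath

variable {V : Type*} {B : Set V}

/-- The path `p`, started at a time when the last visited point of `B` is `y`, visits next the points
in the list, in this order (where successive visits to the same point are counted once). -/
def VisitsInOrder : B → List B → (ℕ → V) → Prop
  | _, [], _ => True
  | y, b :: l, p => ∃ n, (p n = b ∧ b ≠ y) ∧ (∀ m < n, p m ∉ B \ {(y : V)}) ∧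
      VisitsInOrder b l fun k => p (n + k)

lemma measurableSet_visitsInOrder [Countable V] [MeasurableSpace V] [DiscreteMeasurableSpace V]
    (y : B) (l : List B) : MeasurableSet {p : ℕ → V | VisitsInOrder y l p} := by
  induction l generalizing y with
  | nil => exact MeasurableSet.univ
  | cons b l ih =>
    simp only [VisitsInOrder, Set.ofPred_exists]
    refine MeasurableSet.iUnion fun n => ?_
    refine ((measurableSet_eq_fun (measurable_pi_apply n) measurable_const).inter
      (MeasurableSet.const _)).inter (MeasurableSet.inter ?_ ?_)
    · change MeasurableSet {p : ℕ → V | ∀ m < n, p m ∉ B \ {(y : V)}}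
      simp only [Set.ofPred_forall]
      exact MeasurableSet.iInter fun m => MeasurableSet.iInter fun _ =>
        (measurable_pi_apply (X := fun _ : ℕ => V) m)
          (MeasurableSet.of_discrete (s := (B \ {(y : V)})ᶜ))
    · exact (measurable_pi_lambda _ fun k => measurable_pi_apply (n + k)) (ih b)

lemma VisitsInOrder.not_cons_self (y : B) (l : List B) (p : ℕ → V) :
    ¬ VisitsInOrder y (y :: l) p := by
  rintro ⟨_, ⟨_, h⟩, _⟩
  exact h rfl

/-- A step from a point outside `B \ {y}`, possibly `y` itself, leaves the visits still to come
unchanged. This makes visit probabilities harmonic there. -/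
lemma visitsInOrder_shift_iff {y : B} {p : ℕ → V} (hp : p 0 ∉ B \ {(y : V)}) (l : List B) :
    VisitsInOrder y l p ↔ VisitsInOrder y l fun n => p (n + 1) := by
  cases l with
  | nil => exact Iff.rfl
  | cons b l =>
    constructor
    · rintro ⟨n, ⟨hn, hb⟩, hlt, h⟩
      cases n with
      | zero => exact absurd ⟨hn ▸ b.2, fun h' => hb (Subtype.ext (hn.symm.trans h'))⟩ hp
      | succ n =>
        refine ⟨n, ⟨hn, hb⟩, fun m hm => hlt (m + 1) (Nat.succ_lt_succ hm), ?_⟩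
        simpa only [Nat.add_right_comm n _ 1] using h
    · rintro ⟨n, ⟨hn, hb⟩, hlt, h⟩
      refine ⟨n + 1, ⟨hn, hb⟩, fun m hm => ?_, ?_⟩
      · cases m with
        | zero => exact hp
        | succ m => exact hlt m (Nat.lt_of_succ_lt_succ hm)
      · simpa only [Nat.add_right_comm n _ 1] using h

lemma visitsInOrder_cons_iff {y b : B} {p : ℕ → V} (hp : p 0 ∈ B \ {(y : V)}) (l : List B) :
    VisitsInOrder y (b :: l) p ↔ p 0 = b ∧ VisitsInOrder b l p := by
  constructor
  · rintro ⟨n, ⟨hn, _⟩, hlt, h⟩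
    cases n with
    | zero => exact ⟨hn, by simpa only [Nat.zero_add] using h⟩
    | succ n => exact absurd hp (hlt 0 (Nat.succ_pos n))
  · rintro ⟨h0, h⟩
    refine ⟨0, ⟨h0, fun hb => hp.2 (h0.trans (congrArg Subtype.val hb))⟩,
      fun m hm => absurd hm (Nat.not_lt_zero m), by simpa only [Nat.zero_add] using h⟩

lemma visitsInOrder_singleton_unique {y b b' : B} {p : ℕ → V} (h : VisitsInOrder y [b] p)
    (h' : VisitsInOrder y [b'] p) : b = b' := by
  obtain ⟨n, ⟨hn, hb⟩, hlt, -⟩ := h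
  obtain ⟨n', ⟨hn', hb'⟩, hlt', -⟩ := h'
  have hmem : p n ∈ B \ {(y : V)} :=
    ⟨hn ▸ b.2, fun h' => hb (Subtype.ext (hn.symm.trans h'))⟩
  have hmem' : p n' ∈ B \ {(y : V)} :=
    ⟨hn' ▸ b'.2, fun h' => hb' (Subtype.ext (hn'.symm.trans h'))⟩
  obtain rfl : n = n' := le_antisymm (not_lt.1 fun h => hlt n' h hmem')
    (not_lt.1 fun h => hlt' n h hmem)
  exact Subtype.ext (hn.symm.trans hn')

lemma traceTime_succ_eq {p : ℕ → V} {k n : ℕ}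
    (hn : p (traceTime B p k + n) ∈ B \ {p (traceTime B p k)})
    (hlt : ∀ m < n, p (traceTime B p k + m) ∉ B \ {p (traceTime B p k)}) :
    traceTime B p (k + 1) = traceTime B p k + n := by
  -- The current position is not new, so counting from `n = 0` agrees with the bound `T + 1 ≤ n` in
  -- `traceTime`.
  have hn0 : 1 ≤ n := by
    rcases Nat.eq_zero_or_pos n with rfl | h
    · exact absurd rfl hn.2
    · exact h
  have hmem : traceTime B p k + n ∈
      {n | traceTime B p k + 1 ≤ n ∧ p n ∈ B \ {p (traceTime B p k)}} :=
    ⟨Nat.add_le_add_left hn0 _, hn⟩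
  rw [traceTime, if_pos ⟨_, hmem⟩]
  refine le_antisymm (Nat.sInf_le hmem) (le_csInf ⟨_, hmem⟩ fun j hj => ?_)
  by_contra! hlt'
  obtain ⟨m, rfl⟩ := Nat.exists_eq_add_of_le ((Nat.le_succ _).trans hj.1)
  exact hlt m (by omega) hj.2

/-- General `k` is needed for the induction: the visits are read on the shifted path, while the
trace times remain those of the whole path. -/
lemma VisitsInOrder.apply_traceTime {p : ℕ → V} {n : ℕ} {a : ℕ → B} {k : ℕ}
    (h0 : p (traceTime B p k) = a 0)
    (h : VisitsInOrder (a 0) ((List.range n).map fun i => a (i + 1))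
      fun j => p (traceTime B p k + j)) :
    ∀ i ≤ n, p (traceTime B p (k + i)) = a i := by
  induction n generalizing a k with
  | zero =>
    intro i hi
    rw [Nat.le_zero.1 hi]
    exact h0
  | succ n ih =>
    rw [List.range_succ_eq_map, List.map_cons, List.map_map] at h
    obtain ⟨m, ⟨hm, hne⟩, hlt, h⟩ := h
    simp only [Nat.zero_add] at hm hne hlt
    have hT : traceTime B p (k + 1) = traceTime B p k + m := by
      refine traceTime_succ_eq ?_ ?_
      · rw [hm, h0]
        exact ⟨(a 1).2, fun h' => hne (Subtype.ext h')⟩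
      · rw [h0]
        exact hlt
    have hstep := ih (a := fun i => a (i + 1)) (k := k + 1) (by rw [hT]; exact hm) (by
      rw [hT]
      simp only [← Nat.add_assoc] at h
      exact h)
    intro i hi
    cases i with
    | zero => exact h0
    | succ i =>
      have := hstep i (Nat.le_of_succ_le_succ hi)
      rwa [Nat.add_assoc, Nat.add_comm 1 i] at this

/-- One implication suffices, because the laws are compared by an inequality only. Paths whose trace
freezes need no separate treatment. -/
lemma VisitsInOrder.traceSeq_eq {p : ℕ → V} {n : ℕ} {a : ℕ → B} (ρ : B) (h0 : p 0 = a 0)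
    (h : VisitsInOrder (a 0) ((List.range n).map fun i => a (i + 1)) p) :
    ∀ i ≤ n, traceSeq B ρ p i = a i := by
  intro i hi
  have h1 := VisitsInOrder.apply_traceTime (k := 0) h0
    (by simpa only [traceTime, Nat.zero_add] using h) i hi
  rw [Nat.zero_add] at h1
  have h2 : p (traceTime B p i) ∈ B := h1 ▸ (a i).2
  rw [traceSeq, dif_pos h2]
  exact Subtype.ext h1

end TracePath

namespace ElectricalNetwork

/-! ### The law of the traced chain -/

section TraceLaw

variable {V : Type*} [Countable V] [MeasurableSpace V] [DiscreteMeasurableSpace V]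
  {G : ElectricalNetwork V} {f : ℕ → V → ℝ} {B : Set V}

variable (G) in
/-- The probability that the chain started at `z` visits next the points in `l`, if the
last visited point is considered to be `y`. -/
noncomputable def visitProb (y : B) (l : List B) (z : V) : ℝ :=
  G.pathProb {p | VisitsInOrder y l p} z

lemma abs_visitProb_le_one (y : B) (l : List B) (z : V) : |G.visitProb y l z| ≤ 1 :=
  G.abs_pathProb_le_one _ z

lemma visitProb_nonneg (y : B) (l : List B) (z : V) : 0 ≤ G.visitProb y l z :=
  measureReal_nonneg

lemma visitProb_nil (y : B) (z : V) : G.visitProb y [] z = 1 := by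
  have : {p : ℕ → V | VisitsInOrder y [] p} = Set.univ := Set.eq_univ_of_forall fun _ => trivial
  rw [visitProb, this, pathProb, probReal_univ]

lemma visitProb_self (y : B) (l : List B) (z : V) : G.visitProb y (y :: l) z = 0 := by
  have : {p : ℕ → V | VisitsInOrder y (y :: l) p} = ∅ :=
    Set.eq_empty_of_forall_notMem fun p => VisitsInOrder.not_cons_self y l p
  rw [visitProb, this, pathProb, measureReal_empty]

lemma laplacian_visitProb (y : B) (l : List B) {z : V} (hz : z ∉ B \ {(y : V)}) :
    G.laplacian (G.visitProb y l) z = 0 :=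
  G.laplacian_pathProb (measurableSet_visitsInOrder y l) fun p hp =>
    visitsInOrder_shift_iff (by rwa [hp]) l

lemma visitProb_cons_self {y b : B} (hb : b ≠ y) (l : List B) :
    G.visitProb y (b :: l) b = G.visitProb b l b := by
  refine measureReal_congr ?_
  filter_upwards [G.ae_chainLaw_zero b] with p hp
  refine propext ((visitsInOrder_cons_iff ?_ l).trans (and_iff_right hp))
  rw [hp]
  exact ⟨b.2, fun h => hb (Subtype.ext h)⟩

lemma visitProb_cons_of_ne {y b z : B} (hz : z ≠ y) (hzb : z ≠ b) (l : List B) :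
    G.visitProb y (b :: l) z = 0 := by
  have h : G.chainLaw z {p | VisitsInOrder y (b :: l) p} = 0 := by
    rw [measure_eq_zero_iff_ae_notMem]
    filter_upwards [G.ae_chainLaw_zero z] with p hp h
    refine hzb (Subtype.ext (hp.symm.trans ((visitsInOrder_cons_iff ?_ l).1 h).1))
    rw [hp]
    exact ⟨z.2, fun h => hz (Subtype.ext h)⟩
  rw [visitProb, pathProb, measureReal_def, h, ENNReal.toReal_zero]

/-- The strong Markov property at the next visit to a new point of `B`. -/
lemma IsCutoff.visitProb_cons (hf : G.IsCutoff f) (y b : B) (l : List B) (z : V) :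
    G.visitProb y (b :: l) z = G.visitProb b l b * G.visitProb y [b] z := by
  rcases eq_or_ne b y with rfl | hb
  · rw [visitProb_self, visitProb_self, mul_zero]
  have h1 : ∀ z, |G.visitProb b l b * G.visitProb y [b] z| ≤ 1 * 1 := fun z => by
    rw [abs_mul]
    exact mul_le_mul (abs_visitProb_le_one _ _ _) (abs_visitProb_le_one _ _ _) (abs_nonneg _)
      zero_le_one
  -- Both sides are bounded and harmonic off `B \ {y}`. On that set both equal `G.visitProb b l b`
  -- at `b` and `0` elsewhere.
  refine sub_eq_zero.1 (hf.eq_zero_of_harmonic (D := B \ {(y : V)})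
    (u := fun z => G.visitProb y (b :: l) z - G.visitProb b l b * G.visitProb y [b] z)
    (fun z => (abs_sub _ _).trans (add_le_add (abs_visitProb_le_one _ _ z) (h1 z)))
    ⟨b, b.2, fun h => hb (Subtype.ext h)⟩ (fun x hx => ?_) (fun x hx => ?_) z)
  · have hxy : (⟨x, hx.1⟩ : B) ≠ y := fun h => hx.2 (congrArg Subtype.val h)
    rcases eq_or_ne (⟨x, hx.1⟩ : B) b with h | h
    · obtain rfl : x = b := congrArg Subtype.val h
      rw [visitProb_cons_self hb, visitProb_cons_self hb, visitProb_nil, mul_one, sub_self]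
    · have e1 := visitProb_cons_of_ne (G := G) hxy h l
      have e2 := visitProb_cons_of_ne (G := G) hxy h []
      simp only at e1 e2
      rw [e1, e2, mul_zero, sub_self]
  · rw [G.laplacian_sub (abs_visitProb_le_one _ _) h1, G.laplacian_const_mul,
      laplacian_visitProb _ _ hx, laplacian_visitProb _ _ hx, mul_zero, sub_self]

lemma IsCutoff.traceCond_eq_visitProb (hf : G.IsCutoff f) {x y : B} (hxy : x ≠ y) :
    G.traceCond B y x = G.visitProb y [x] y *
      G.energy (G.harmonicMeasure B y) (G.harmonicMeasure B y) :=
  hf.traceCond_eq_mul hxy (abs_visitProb_le_one y [x])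
    (by rw [visitProb_cons_self hxy, visitProb_nil])
    (fun _ hb hbx => visitProb_cons_of_ne hb hbx []) fun _ hz => laplacian_visitProb y [x] hz

/-- The chain visits a new point of `B` almost surely. -/
lemma IsCutoff.hasSum_visitProb (hf : G.IsCutoff f) {x y : B} (hxy : x ≠ y) (z : V) :
    HasSum (fun b : B => G.visitProb y [b] z) 1 := by
  let S : Set (ℕ → V) := ⋃ b : B, {p | VisitsInOrder y [b] p}
  have hS : MeasurableSet S :=
    MeasurableSet.iUnion fun b => measurableSet_visitsInOrder y [b]
  have hone : G.pathProb S z = 1 := by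
    have h1 : ∀ _ : V, |(1 : ℝ)| ≤ 1 := fun _ => by rw [abs_one]
    -- The probability of ever entering `B \ {y}` is harmonic off this set and `1` on it, hence
    -- identically `1`; the point `x` makes the set non-empty.
    refine sub_eq_zero.1 (hf.eq_zero_of_harmonic (D := B \ {(y : V)})
      (u := fun z => G.pathProb S z - 1)
      (fun z => (abs_sub _ _).trans (add_le_add (G.abs_pathProb_le_one S z) (h1 z)))
      ⟨x, x.2, fun h => hxy (Subtype.ext h)⟩ (fun b hb => ?_) (fun b hb => ?_) z)
    · have h2 : G.chainLaw b S = 1 := by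
        rw [← mem_ae_iff_prob_eq_one hS]
        filter_upwards [G.ae_chainLaw_zero b] with p hp
        exact Set.mem_iUnion.2 ⟨⟨b, hb.1⟩, (visitsInOrder_cons_iff (by rwa [hp]) []).2
          ⟨hp, trivial⟩⟩
      rw [pathProb, measureReal_def, h2, ENNReal.toReal_one, sub_self]
    · rw [G.laplacian_sub (G.abs_pathProb_le_one S) h1, G.laplacian_pathProb hS fun p hp => ?_]
      · simp [laplacian]
      · simp only [S, Set.mem_iUnion, Set.mem_ofPred_eq]
        exact exists_congr fun c => visitsInOrder_shift_iff (by rwa [hp]) [c]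
  have hU : G.chainLaw z S = ∑' b : B, G.chainLaw z {p | VisitsInOrder y [b] p} :=
    measure_iUnion (fun b b' hbb' => Set.disjoint_left.2 fun p hp hp' =>
      hbb' (visitsInOrder_singleton_unique hp hp')) fun b => measurableSet_visitsInOrder y [b]
  have hne : ∑' b : B, G.chainLaw z {p | VisitsInOrder y [b] p} ≠ ∞ := hU ▸ measure_ne_top _ _
  have hsum := ENNReal.hasSum_toReal hne
  rw [← ENNReal.tsum_toReal_eq (fun b => measure_ne_top _ _), ← hU] at hsum
  rw [← hone]
  exact hsum

/-- Each trace conductance is an exit probability times the energy, and the exit probabilities sum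
to one. -/
lemma IsCutoff.hasSum_traceCond (hf : G.IsCutoff f) {x y : B} (hxy : x ≠ y) :
    HasSum (G.traceCond B y) (G.energy (G.harmonicMeasure B y) (G.harmonicMeasure B y)) := by
  have h := (hf.hasSum_visitProb hxy y).mul_right
    (G.energy (G.harmonicMeasure B y) (G.harmonicMeasure B y))
  rw [one_mul] at h
  refine h.congr_fun fun b => ?_
  rcases eq_or_ne b y with rfl | hb
  · rw [traceCond_self, visitProb_self, zero_mul]
  · exact hf.traceCond_eq_visitProb hb

/-- The trace of a recurrent network on a non-empty set, as a network. -/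
noncomputable def IsCutoff.trace (hf : G.IsCutoff f) (hB : B.Nonempty) : ElectricalNetwork B where
  graph := G.traceGraph B
  connected := hf.connected_traceGraph hB
  cond := G.traceCond B
  cond_nonneg := hf.traceCond_nonneg
  cond_symm := traceCond_comm
  cond_pos_iff _ _ := Iff.rfl
  summable_cond y := by
    by_cases h : ∃ x, x ≠ y
    · obtain ⟨x, hxy⟩ := h
      exact (hf.hasSum_traceCond hxy).summable
    -- If `B` is a single point there is nowhere to exit, but the sum has one term.
    · push Not at h
      have : Subsingleton B := ⟨fun a b => (h a).trans (h b).symm⟩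
      exact Summable.of_finite

lemma IsCutoff.transProb_trace (hf : G.IsCutoff f) (hB : B.Nonempty) [Nontrivial B] (y x : B) :
    (hf.trace hB).transProb y x = G.visitProb y [x] y := by
  obtain ⟨x', hx'⟩ := exists_ne y
  have hE := hf.energy_harmonicMeasure_pos hx'.symm
  have htot : (hf.trace hB).totalCond y =
      G.energy (G.harmonicMeasure B y) (G.harmonicMeasure B y) :=
    (hf.hasSum_traceCond hx').tsum_eq
  rw [transProb, htot, if_neg hE.ne', div_eq_iff hE.ne']
  change G.traceCond B y x = _
  rcases eq_or_ne x y with rfl | h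
  · rw [traceCond_self, visitProb_self, zero_mul]
  · exact hf.traceCond_eq_visitProb h

/-- The strong Markov property peels off the first visit, which contributes the factor with index
`0`; the rest is the same statement for the shifted sequence. -/
lemma IsCutoff.visitProb_map_range (hf : G.IsCutoff f) (hB : B.Nonempty) [Nontrivial B] (n : ℕ)
    (a : ℕ → B) : ENNReal.ofReal (G.visitProb (a 0) ((List.range n).map fun i => a (i + 1)) (a 0)) =
      ∏ i ∈ Finset.range n, (hf.trace hB).stepPMF (a i) (a (i + 1)) := by
  induction n generalizing a with
  | zero => simp [visitProb_nil]
  | succ n ih =>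
    rw [List.range_succ_eq_map, List.map_cons, List.map_map, hf.visitProb_cons,
      Finset.prod_range_succ', ENNReal.ofReal_mul (visitProb_nonneg _ _ _),
      ← hf.transProb_trace hB]
    exact congrArg₂ (· * ·) (ih fun i => a (i + 1)) rfl

/-- The trace of the chain of a recurrent network is the chain of its trace. -/
lemma IsCutoff.chainLaw_map_traceSeq (hf : G.IsCutoff f) (hB : B.Nonempty) (ρ : B) :
    (G.chainLaw ρ).map (traceSeq B ρ) = (hf.trace hB).chainLaw ρ := by
  have hm := measurable_traceSeq B ρ
  have := Measure.isProbabilityMeasure_map (μ := G.chainLaw ρ) hm.aemeasurable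
  symm
  refine Measure.ext_of_le_cylinder fun n a => ?_
  rcases subsingleton_or_nontrivial B with hsub | hnt
  -- On a single point there is only one sequence, so no exit probability is needed.
  · have huniv : {p : ℕ → B | ∀ i ≤ n, p i = a i} = Set.univ :=
      Set.eq_univ_of_forall fun p i _ => Subsingleton.elim _ _
    rw [huniv, measure_univ, measure_univ]
  · rw [chainLaw_cylinder]
    split_ifs with h0
    · subst h0
      rw [one_mul, ← hf.visitProb_map_range hB, Measure.map_apply hm (measurableSet_cylinder n a),
        visitProb, pathProb, ofReal_measureReal]
      -- Almost every path that visits the prescribed points in order has the prescribed trace.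
      refine measure_mono_ae ?_
      filter_upwards [G.ae_chainLaw_zero (a 0)] with p hp h
      exact VisitsInOrder.traceSeq_eq (a 0) hp h
    · rw [zero_mul]
      exact zero_le

end TraceLaw

end ElectricalNetwork

theorem theorem4 {V : Type*} [Countable V] [MetricSpace V] [DiscreteTopology V]
    [MeasurableSpace V] [DiscreteMeasurableSpace V]
    (G : ElectricalNetwork V) (hG : G.BoundedlyCompact) (hrec : G.Recurrent)
    (B : Set V) (hB : B.Nonempty) :
    ∃ H : ElectricalNetwork B, G.IsTrace B H ∧
      ∀ ρ : B,
        (G.chainLaw ρ).map (fun p => Cadlag.ofSeq (traceSeq B ρ p)) =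
          (H.chainLaw ρ).map Cadlag.ofSeq := by
  obtain ⟨f, hf⟩ := G.exists_isCutoff hG hrec
  refine ⟨hf.trace hB, fun x y => rfl, fun ρ => ?_⟩
  rw [← hf.chainLaw_map_traceSeq hB, Measure.map_map Cadlag.measurable_ofSeq
    (measurable_traceSeq B ρ)]
  rfl
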